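/- Let $m\ge 1$, $n\ge 0$ and $2\le k\le\infty$. For an embedded closed (compact, without boundary, not necessarily connected) oriented $m$-dimensional submanifold $M\subset\mathbb{R}^n$ of class $C^k$ and distinct $x,y\in M$, let $\Sigma_x(y)$ be the unique $m$-sphere (an affine $m$-plane if $y-x\in T_xM$) that is tangent to $M$ at $x$ and passes through $y$, oriented so that its orientation agrees with that of $M$ at $x$. Define the combined angle $\theta_M(x,y)$ by $$\cos\theta_M(x,y)=\det\big(\langle u_i,v_j\rangle\big)_{1\le i,j\le m},$$ where $u_1,\dots,u_m$ and $v_1,\dots,v_m$ are positively oriented orthonormal bases of $T_y\Sigma_x(y)$ and $T_yM$, respectively. The Kusner--Sullivan energy of $M$ is $$E_{KS}(M)=\iint_{M\times M}\frac{(1-\cos\theta_M(x,y))^m}{|x-y|^{2m}}\,dx\,dy\in[0,\infty],$$ where $dx$ and $dy$ denote the $m$-dimensional volume on $M$. Equip the set $C^k(N,\mathbb{R}^n)$ of $C^k$ maps from a closed oriented $m$-dimensional $C^k$-manifold $N$ to $\mathbb{R}^n$ with the compact-open $C^2$-topology (uniform convergence, on compact subsets of charts, of all partial derivatives of order at most $2$),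 and the set $\mathrm{Emb}^k(N,\mathbb{R}^n)$ of $C^k$ embeddings with the subspace topology. The space of embedded closed oriented $m$-dimensional submanifolds of $\mathbb{R}^n$ of class $C^k$, with its $C^2$-topology, is the disjoint union $$\bigsqcup_{N}\ \mathrm{Emb}^k(N,\mathbb{R}^n)/\mathrm{Diff}^k_+(N)$$ over the oriented $C^k$-diffeomorphism types of such $N$, where the group $\mathrm{Diff}^k_+(N)$ of orientation preserving $C^k$-diffeomorphisms acts by composition, and each quotient carries the quotient topology. Then $E_{KS}$ is finite on this space, and it is continuous with respect to the $C^2$-topology. -/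

import Mathlib

open Set MeasureTheory
open scoped Topology Manifold ContDiff ENNReal InnerProductSpace

noncomputable section

namespace KusnerSullivan

abbrev Euc (d : ℕ) : Type := EuclideanSpace ℝ (Fin d)

/-! ### Closed oriented manifolds -/

/-- A closed (compact, Hausdorff, boundaryless, not necessarily connected) `m`-dimensional manifold
of class `C^k`, oriented by means of an oriented atlas: all the changes of charts have positive
Jacobian determinant. -/
structure ClosedOrientedManifold (m : ℕ) (k : ℕ∞) : Type 1 where
  carrier : Type
  [top : TopologicalSpace carrier]
  [charted : ChartedSpace (Euc m) carrier]
  [isManifold : IsManifold 𝓘(ℝ, Euc m) k carrier]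
  [compact : CompactSpace carrier]
  [t2 : T2Space carrier]
  oriented : ∀ φ ∈ atlas (Euc m) carrier, ∀ φ' ∈ atlas (Euc m) carrier,
    ∀ p ∈ φ.source ∩ φ'.source, 0 < (fderiv ℝ (φ' ∘ φ.symm) (φ p)).det

instance (m : ℕ) (k : ℕ∞) : CoeSort (ClosedOrientedManifold m k) Type :=
  ⟨ClosedOrientedManifold.carrier⟩

attribute [instance] ClosedOrientedManifold.top ClosedOrientedManifold.charted
  ClosedOrientedManifold.isManifold ClosedOrientedManifold.compact ClosedOrientedManifold.t2

variable {m n : ℕ} {k : ℕ∞}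

/-- A diffeomorphism is orientation preserving if its Jacobian determinants in the charts of the
two oriented atlases are positive. -/
def IsOrientationPreserving {M N : ClosedOrientedManifold m k}
    (Φ : M ≃ₘ^k⟮𝓘(ℝ, Euc m), 𝓘(ℝ, Euc m)⟯ N) : Prop :=
  ∀ φ ∈ atlas (Euc m) M, ∀ ψ ∈ atlas (Euc m) N, ∀ p ∈ φ.source, Φ p ∈ ψ.source →
    0 < (fderiv ℝ (ψ ∘ Φ ∘ φ.symm) (φ p)).det

/-! ### The compact-open `C^q` topology -/

section CompactOpen

variable {M : Type} [TopologicalSpace M] [ChartedSpace (Euc m) M]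
  {N : Type} [TopologicalSpace N] [ChartedSpace (Euc n) N]

/-- The set of `g` in `C^k(M, N)` that map `K` into the domain of the chart `ψ`, and whose partial
derivatives of order at most `q`, read in the charts `φ` and `ψ`, differ from those of `f` by less
than `ε` on `φ(K)`. The tuple `μ` lists the directions of differentiation. -/
def subbasicSet (q : ℕ) (f : C^k⟮𝓘(ℝ, Euc m), M; 𝓘(ℝ, Euc n), N⟯)
    (φ : OpenPartialHomeomorph M (Euc m)) (ψ : OpenPartialHomeomorph N (Euc n))
    (K : Set M) (ε : ℝ) : Set C^k⟮𝓘(ℝ, Euc m), M; 𝓘(ℝ, Euc n), N⟯ :=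
  {g | MapsTo g K ψ.source ∧ ∀ x ∈ φ '' K, ∀ j ≤ q, ∀ μ : Fin j → Fin m,
    ‖iteratedFDeriv ℝ j (ψ ∘ g ∘ φ.symm) x (fun i => EuclideanSpace.single (μ i) 1)
      - iteratedFDeriv ℝ j (ψ ∘ f ∘ φ.symm) x (fun i => EuclideanSpace.single (μ i) 1)‖ < ε}

/-- The compact-open `C^q` topology (weak topology) on `C^k(M, N)`. -/
@[reducible] def compactOpenTopology (q : ℕ) : TopologicalSpace C^k⟮𝓘(ℝ, Euc m), M; 𝓘(ℝ, Euc n), N⟯ :=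
  TopologicalSpace.generateFrom
    {S | ∃ (f : C^k⟮𝓘(ℝ, Euc m), M; 𝓘(ℝ, Euc n), N⟯)
      (φ : OpenPartialHomeomorph M (Euc m)) (ψ : OpenPartialHomeomorph N (Euc n))
      (K : Set M) (ε : ℝ),
      φ ∈ IsManifold.maximalAtlas 𝓘(ℝ, Euc m) k M ∧
      ψ ∈ IsManifold.maximalAtlas 𝓘(ℝ, Euc n) k N ∧
      IsCompact K ∧ K ⊆ φ.source ∧ MapsTo f K ψ.source ∧ 0 < ε ∧
      S = subbasicSet q f φ ψ K ε}

end CompactOpen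

/-! ### Embeddings and the space of embedded submanifolds -/

/-- `C^k` embeddings of `M` into `ℝⁿ`. -/
structure Emb (M : ClosedOrientedManifold m k) (n : ℕ) : Type where
  toMap : C^k⟮𝓘(ℝ, Euc m), M; 𝓘(ℝ, Euc n), Euc n⟯
  immersion : ∀ p : M, Function.Injective (mfderiv 𝓘(ℝ, Euc m) 𝓘(ℝ, Euc n) toMap p)
  isEmbedding : Topology.IsEmbedding toMap

/-- The compact-open `C^q` topology on `C^k` embeddings. -/
@[reducible] def embTopology (q : ℕ) (M : ClosedOrientedManifold m k) (n : ℕ) : TopologicalSpace (Emb M n) :=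
  TopologicalSpace.induced Emb.toMap (compactOpenTopology q)

/-- Two embeddings define the same oriented submanifold if they differ by an orientation preserving
diffeomorphism of their domains. This is an equivalence relation. -/
def SameSubmanifold (a b : Σ M : ClosedOrientedManifold m k, Emb M n) : Prop :=
  ∃ Φ : a.1 ≃ₘ^k⟮𝓘(ℝ, Euc m), 𝓘(ℝ, Euc m)⟯ b.1,
    IsOrientationPreserving Φ ∧ ∀ p, a.2.toMap p = b.2.toMap (Φ p)

/-- The set of embedded closed oriented `m`-dimensional submanifolds of `ℝⁿ` of class `C^k`: the
disjoint union, over the diffeomorphism types of `M`, of the embeddings of `M` modulo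
diffeomorphisms. -/
def EmbeddedSubmanifold (m n : ℕ) (k : ℕ∞) : Type 1 :=
  Quot (SameSubmanifold (m := m) (n := n) (k := k))

/-- The `C^q` topology on the space of embedded submanifolds: the quotient of the disjoint union of
the compact-open `C^q` topologies. -/
@[reducible] def submanifoldTopology (m n : ℕ) (k : ℕ∞) (q : ℕ) :
    TopologicalSpace (EmbeddedSubmanifold m n k) :=
  TopologicalSpace.coinduced (Quot.mk _)
    (@instTopologicalSpaceSigma (ClosedOrientedManifold m k) (fun M => Emb M n)
      (fun M => embTopology q M n))

/-! ### The combined angle -/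

/-- `b'` is obtained from `b` by a matrix of positive determinant. For bases of the same vector
space this means that they define the same orientation. -/
def SameOrientation {d : ℕ} (b b' : Fin d → Euc n) : Prop :=
  ∃ A : Matrix (Fin d) (Fin d) ℝ, 0 < A.det ∧ ∀ i, b' i = ∑ j, A i j • b j

/-- The positively oriented bases of the tangent space `T_x f(M)`. -/
def positiveFrames {M : ClosedOrientedManifold m k} (f : M → Euc n) (x : Euc n) :
    Set (Fin m → Euc n) :=
  {e | ∃ φ ∈ atlas (Euc m) M, ∃ p ∈ φ.source, f p = x ∧
    SameOrientation
      (fun i => fderiv ℝ (f ∘ φ.symm) (φ p) (EuclideanSpace.single i 1)) e}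

/-- Let `e` be an oriented basis of an `m`-plane `P`, and let `Σ` be the oriented `m`-sphere through
`y` that is tangent to `P` at `x` and has the orientation of `e` there. The predicate says that `u`
is a positively oriented basis of `T_y Σ`.

If `y - x` is in `P`, then `Σ` is the oriented plane `x + P`. Otherwise `Σ` is the round sphere with
some centre `c` in the affine `(m+1)`-space spanned by `x + P` and `y`; with `W` the direction of
that space, the tangent space of `Σ` at a point `z` is the orthogonal complement of `z - c` in `W`,
and a basis `w` of it is positive if `(z - c, w)` is a positive basis of `W`, where `W` is oriented
in such a way that `e` is positive at `x`. -/
def IsSphereFrame (x y : Euc n) (e u : Fin m → Euc n) : Prop :=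
  (y - x ∈ Submodule.span ℝ (range e) ∧ SameOrientation e u) ∨
  ∃ c : Euc n, c ≠ x ∧ (∀ i, ⟪e i, x - c⟫_ℝ = 0) ∧ dist y c = dist x c ∧
    y - c ∈ Submodule.span ℝ (insert (x - c) (range e)) ∧ (∀ i, ⟪u i, y - c⟫_ℝ = 0) ∧
    SameOrientation (Fin.cons (x - c) e : Fin (m + 1) → Euc n) (Fin.cons (y - c) u)

/-- `r` is the cosine of the combined angle of an oriented submanifold at `x` and `y`, where `T x`
is the set of the positively oriented bases of its tangent space at `x`: `r = det ⟨uᵢ, vⱼ⟩` for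
positively oriented orthonormal bases `u` of `T_y Σ_x(y)` and `v` of the tangent space at `y`. -/
def IsCosCombinedAngle (T : Euc n → Set (Fin m → Euc n)) (x y : Euc n) (r : ℝ) : Prop :=
  ∃ e ∈ T x, ∃ u, IsSphereFrame x y e u ∧ Orthonormal ℝ u ∧
    ∃ v ∈ T y, Orthonormal ℝ v ∧ r = (Matrix.of fun i j => ⟪u i, v j⟫_ℝ).det

/-- The cosine of the combined angle, that is, the number `r` with `IsCosCombinedAngle T x y r`. -/
def cosCombinedAngle (T : Euc n → Set (Fin m → Euc n)) (x y : Euc n) : ℝ :=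
  Classical.epsilon (IsCosCombinedAngle T x y)

/-! ### The energy -/

/-- The Kusner–Sullivan energy of the image of `f`; `μHE[m]` is the `m`-dimensional volume, i.e. the
Hausdorff measure normalized to agree with Lebesgue measure on `ℝᵐ`. -/
def energyOfMap {M : ClosedOrientedManifold m k} (f : M → Euc n) : ℝ≥0∞ :=
  ∫⁻ x in range f, ∫⁻ y in range f,
    ENNReal.ofReal ((1 - cosCombinedAngle (positiveFrames f) x y) ^ m / dist x y ^ (2 * m))
      ∂μHE[m] ∂μHE[m]

theorem SameOrientation.symm {d : ℕ} {b b' : Fin d → Euc n} (h : SameOrientation b b') :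
    SameOrientation b' b := by
  obtain ⟨A, hA, h⟩ := h
  refine ⟨A⁻¹, ?_, fun i => ?_⟩
  · rw [Matrix.det_nonsing_inv, Ring.inverse_eq_inv']
    exact inv_pos.mpr hA
  · have hu : IsUnit A.det := hA.ne'.isUnit
    simp_rw [h, Finset.smul_sum, smul_smul]
    rw [Finset.sum_comm]
    simp_rw [← Finset.sum_smul, ← Matrix.mul_apply, Matrix.nonsing_inv_mul A hu, Matrix.one_apply]
    simp

theorem SameOrientation.trans {d : ℕ} {b b' b'' : Fin d → Euc n} (h : SameOrientation b b')
    (h' : SameOrientation b' b'') : SameOrientation b b'' := by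
  obtain ⟨A, hA, h⟩ := h
  obtain ⟨B, hB, h'⟩ := h'
  refine ⟨B * A, by rw [Matrix.det_mul]; exact mul_pos hB hA, fun i => ?_⟩
  simp_rw [h', h, Finset.smul_sum, smul_smul]
  rw [Finset.sum_comm]
  simp_rw [← Finset.sum_smul, ← Matrix.mul_apply]

theorem sameOrientation_coordinateFrame {M N : ClosedOrientedManifold m k} (hk : 1 ≤ k)
    {f : M → Euc n} {g : C^k⟮𝓘(ℝ, Euc m), N; 𝓘(ℝ, Euc n), Euc n⟯}
    {Φ : M ≃ₘ^k⟮𝓘(ℝ, Euc m), 𝓘(ℝ, Euc m)⟯ N} (hΦ : IsOrientationPreserving Φ)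
    (hf : ∀ p, f p = g (Φ p)) {φ : OpenPartialHomeomorph M (Euc m)} (hφ : φ ∈ atlas (Euc m) M)
    {ψ : OpenPartialHomeomorph N (Euc m)} (hψ : ψ ∈ atlas (Euc m) N) {p : M} (hp : p ∈ φ.source)
    (hq : Φ p ∈ ψ.source) :
    SameOrientation
      (fun i => fderiv ℝ (g ∘ ψ.symm) (ψ (Φ p)) (EuclideanSpace.single i 1))
      (fun i => fderiv ℝ (f ∘ φ.symm) (φ p) (EuclideanSpace.single i 1)) := by
  have hk' : (k : WithTop ℕ∞) ≠ 0 := by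
    have : k ≠ 0 := (zero_lt_one.trans_le hk).ne'
    exact_mod_cast this
  have hk1 : (1 : WithTop ℕ∞) ≤ k := by exact_mod_cast hk
  have : IsManifold 𝓘(ℝ, Euc m) 1 M := IsManifold.of_le hk1
  have : IsManifold 𝓘(ℝ, Euc m) 1 N := IsManifold.of_le hk1
  have hpt : φ p ∈ φ.target := φ.map_source hp
  have hqt : ψ (Φ p) ∈ ψ.target := ψ.map_source hq
  have hsp : φ.symm (φ p) = p := φ.left_inv hp
  have hsq : ψ.symm (ψ (Φ p)) = Φ p := ψ.left_inv hq
  have dφ : MDifferentiableAt 𝓘(ℝ, Euc m) 𝓘(ℝ, Euc m) φ.symm (φ p) :=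
    mdifferentiableAt_atlas_symm hφ hpt
  have dψs : MDifferentiableAt 𝓘(ℝ, Euc m) 𝓘(ℝ, Euc m) ψ.symm (ψ (Φ p)) :=
    mdifferentiableAt_atlas_symm hψ hqt
  have dψ : MDifferentiableAt 𝓘(ℝ, Euc m) 𝓘(ℝ, Euc m) ψ (Φ p) :=
    mdifferentiableAt_atlas hψ hq
  have dΦ : MDifferentiableAt 𝓘(ℝ, Euc m) 𝓘(ℝ, Euc m) Φ p := Φ.mdifferentiable hk' p
  have dg : MDifferentiableAt 𝓘(ℝ, Euc m) 𝓘(ℝ, Euc n) g (Φ p) :=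
    g.contMDiff.mdifferentiable hk' _
  have d1 : DifferentiableAt ℝ (ψ ∘ Φ ∘ φ.symm) (φ p) := by
    rw [← mdifferentiableAt_iff_differentiableAt]
    refine MDifferentiableAt.comp (I' := 𝓘(ℝ, Euc m)) _ ?_
      (MDifferentiableAt.comp (I' := 𝓘(ℝ, Euc m)) _ ?_ dφ)
    · simpa [hsp] using dψ
    · simpa [hsp] using dΦ
  have d2 : DifferentiableAt ℝ (g ∘ ψ.symm) (ψ (Φ p)) := by
    rw [← mdifferentiableAt_iff_differentiableAt]
    refine MDifferentiableAt.comp (I' := 𝓘(ℝ, Euc m)) _ ?_ dψs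
    simpa [hsq] using dg
  have hval : (ψ ∘ Φ ∘ φ.symm) (φ p) = ψ (Φ p) := by simp [hsp]
  have hev : f ∘ φ.symm =ᶠ[nhds (φ p)] (g ∘ ψ.symm) ∘ (ψ ∘ Φ ∘ φ.symm) := by
    have hc : ContinuousAt (Φ ∘ φ.symm) (φ p) :=
      Φ.continuous.continuousAt.comp (φ.continuousAt_symm hpt)
    have hm : ψ.source ∈ nhds ((Φ ∘ φ.symm) (φ p)) := by
      simpa [hsp] using ψ.open_source.mem_nhds hq
    filter_upwards [hc hm] with z hz
    have hz' : Φ (φ.symm z) ∈ ψ.source := hz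
    simp [hf, ψ.left_inv hz']
  have hchain : fderiv ℝ (f ∘ φ.symm) (φ p) =
      (fderiv ℝ (g ∘ ψ.symm) (ψ (Φ p))).comp (fderiv ℝ (ψ ∘ Φ ∘ φ.symm) (φ p)) := by
    rw [hev.fderiv_eq, fderiv_comp _ (by rwa [hval]) d1, hval]
  set J := fderiv ℝ (ψ ∘ Φ ∘ φ.symm) (φ p) with hJ
  have hdet : 0 < J.det := hΦ φ hφ ψ hψ p hp hq
  let B := (EuclideanSpace.basisFun (Fin m) ℝ).toBasis
  refine ⟨(LinearMap.toMatrix B B (J : Euc m →ₗ[ℝ] Euc m)).transpose, ?_, fun i => ?_⟩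
  · rw [Matrix.det_transpose, LinearMap.det_toMatrix]
    exact hdet
  · have hexp : J (EuclideanSpace.single i 1) =
        ∑ j, (J (EuclideanSpace.single i 1)) j • (EuclideanSpace.single j (1 : ℝ) : Euc m) := by
      simpa using ((EuclideanSpace.basisFun (Fin m) ℝ).sum_repr (J (EuclideanSpace.single i 1))).symm
    simp only [hchain, ContinuousLinearMap.comp_apply]
    conv_lhs => rw [hexp]
    simp [B, LinearMap.toMatrix_apply, map_sum, map_smul]

theorem positiveFrames_comp {M N : ClosedOrientedManifold m k} (hk : 1 ≤ k)
    {f : M → Euc n} {g : C^k⟮𝓘(ℝ, Euc m), N; 𝓘(ℝ, Euc n), Euc n⟯}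
    {Φ : M ≃ₘ^k⟮𝓘(ℝ, Euc m), 𝓘(ℝ, Euc m)⟯ N} (hΦ : IsOrientationPreserving Φ)
    (hf : ∀ p, f p = g (Φ p)) : positiveFrames f = positiveFrames (g : N → Euc n) := by
  ext x e
  constructor
  · rintro ⟨φ, hφ, p, hp, hx, h⟩
    have hq := mem_chart_source (Euc m) (Φ p)
    have hψ := chart_mem_atlas (Euc m) (Φ p)
    exact ⟨_, hψ, Φ p, hq, by rw [← hf, hx],
      (sameOrientation_coordinateFrame hk hΦ hf hφ hψ hp hq).trans h⟩
  · rintro ⟨ψ, hψ, q, hq, hx, h⟩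
    obtain ⟨p, rfl⟩ : ∃ p, Φ p = q := Φ.surjective q
    have hp := mem_chart_source (Euc m) p
    have hφ := chart_mem_atlas (Euc m) p
    exact ⟨_, hφ, p, hp, by rw [hf, hx],
      (sameOrientation_coordinateFrame hk hΦ hf hφ hψ hp hq).symm.trans h⟩

/-- The energy depends only on the oriented submanifold. -/
theorem energyOfMap_eq (hk : 2 ≤ k) (a b : Σ M : ClosedOrientedManifold m k, Emb M n)
    (h : SameSubmanifold a b) : energyOfMap a.2.toMap = energyOfMap b.2.toMap := by
  obtain ⟨Φ, hΦ, hf⟩ := h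
  have h1 : positiveFrames (a.2.toMap : a.1 → Euc n) = positiveFrames (b.2.toMap : b.1 → Euc n) :=
    positiveFrames_comp (one_le_two.trans hk) hΦ hf
  have h2 : range (a.2.toMap : a.1 → Euc n) = range (b.2.toMap : b.1 → Euc n) := by
    have : (a.2.toMap : a.1 → Euc n) = (b.2.toMap : b.1 → Euc n) ∘ Φ := funext hf
    have hs : Function.Surjective Φ := Φ.surjective
    rw [this, hs.range_comp]
  simp only [energyOfMap, h1, h2]

/-- The Kusner–Sullivan energy
`E_KS(M) = ∫_M ∫_M (1 - cos θ_M(x, y))^m / |x - y|^(2m) dy dx` on the set of embedded closed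
oriented `m`-dimensional submanifolds of `ℝⁿ` of class `C^k`, `k ≥ 2`. -/
def energyKS (hk : 2 ≤ k) : EmbeddedSubmanifold m n k → ℝ≥0∞ :=
  Quot.lift (fun a => energyOfMap a.2.toMap) (energyOfMap_eq hk)

end KusnerSullivan

end

/-!
Let `R_v` be the reflection in `v⊥`. The tangent plane of `Σ_x(y)` at `y` is the image of `T_xM`
under `R_{y-x}` with the reversed orientation, so `cos θ_M(x, y) = -⟨R_{y-x} T_xM, T_yM⟩`, where
`⟨·, ·⟩` is the inner product of oriented planes, expressed through Gram determinants of arbitrary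
positive frames. Near the diagonal a `C^2` bound on the parametrization makes `y - x` tangential up
to `O(|x - y|²)` and turns the tangent plane by `O(|x - y|)`, whence `1 - cos θ_M = O(|x - y|²)`,
uniformly in a `C^2` neighbourhood of the embedding, and the integrand is bounded. Together with its
pointwise convergence off the diagonal, dominated convergence over the fixed parameter space handles
the integrand; the volumes are handled by noting that `C^2`-close (even `C^1`-close) embeddings are
bi-Lipschitz to each other with constants close to `1`.
-/

noncomputable section

namespace KusnerSullivan

open Filter Asymptotics
open scoped NNReal Matrix

/-! ### Frames and the cosine between oriented planes -/

section Frames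

variable {E : Type*} [NormedAddCommGroup E] [InnerProductSpace ℝ E] {ι κ η : Type*}

/-- The frame obtained from `a` by the matrix `A`, whose rows list the coefficients of the new
vectors. -/
def changeFrame [Fintype κ] (A : Matrix ι κ ℝ) (a : κ → E) : ι → E :=
  fun i => ∑ j, A i j • a j

/-- The matrix of the inner products of the vectors of two frames. -/
def crossGram (a : ι → E) (b : κ → E) : Matrix ι κ ℝ :=
  Matrix.of fun i j => ⟪a i, b j⟫_ℝ

/-- The cosine of the angle between the oriented planes spanned by two frames of the same length,
that is, the inner product of the normalised wedge products of the frames. It is `0` if one of the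
frames is linearly dependent. -/
def frameCos [Fintype ι] [DecidableEq ι] (a b : ι → E) : ℝ :=
  (crossGram a b).det / (√(crossGram a a).det * √(crossGram b b).det)

theorem crossGram_transpose (a : ι → E) (b : κ → E) : (crossGram a b)ᵀ = crossGram b a := by
  ext i j
  simp [crossGram, real_inner_comm]

theorem crossGram_add_left (a b : ι → E) (c : κ → E) :
    crossGram (a + b) c = crossGram a c + crossGram b c := by
  ext i j
  simp [crossGram, inner_add_left]

theorem crossGram_add_right (a : ι → E) (b c : κ → E) :
    crossGram a (b + c) = crossGram a b + crossGram a c := by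
  ext i j
  simp [crossGram, inner_add_right]

theorem continuous_crossGram :
    Continuous fun ab : (ι → E) × (κ → E) => crossGram ab.1 ab.2 := by
  refine continuous_matrix fun i j => ?_
  simp only [crossGram, Matrix.of_apply]
  fun_prop

theorem crossGram_self_eq_one_iff [DecidableEq ι] {a : ι → E} :
    crossGram a a = 1 ↔ Orthonormal ℝ a :=
  Matrix.gram_eq_one_iff_orthonormal

theorem changeFrame_one [Fintype ι] [DecidableEq ι] (a : ι → E) :
    changeFrame (1 : Matrix ι ι ℝ) a = a := by
  ext1 i
  simp [changeFrame, Matrix.one_apply]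

theorem changeFrame_changeFrame [Fintype κ] [Fintype η] (A : Matrix ι κ ℝ) (B : Matrix κ η ℝ)
    (a : η → E) : changeFrame A (changeFrame B a) = changeFrame (A * B) a := by
  ext1 i
  simp_rw [changeFrame, Finset.smul_sum, smul_smul]
  rw [Finset.sum_comm]
  simp_rw [← Finset.sum_smul, ← Matrix.mul_apply]

theorem comp_changeFrame [Fintype κ] (R : E ≃ₗᵢ[ℝ] E) (A : Matrix ι κ ℝ) (a : κ → E) :
    R ∘ changeFrame A a = changeFrame A (R ∘ a) := by
  ext1 i
  simp [changeFrame, map_sum]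

theorem exists_eq_changeFrame [Fintype κ] {a : κ → E} {b : ι → E}
    (h : ∀ i, b i ∈ Submodule.span ℝ (range a)) : ∃ A : Matrix ι κ ℝ, b = changeFrame A a := by
  choose A hA using fun i => (Submodule.mem_span_range_iff_exists_fun ℝ).1 (h i)
  exact ⟨Matrix.of A, funext fun i => (hA i).symm⟩

theorem sameOrientation_iff {d n : ℕ} {b b' : Fin d → Euc n} :
    SameOrientation b b' ↔ ∃ A : Matrix (Fin d) (Fin d) ℝ, 0 < A.det ∧ b' = changeFrame A b := by
  simp only [SameOrientation, funext_iff, changeFrame]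

theorem crossGram_changeFrame_left [Fintype κ] (A : Matrix ι κ ℝ) (a : κ → E) (b : η → E) :
    crossGram (changeFrame A a) b = A * crossGram a b := by
  ext i j
  simp [crossGram, changeFrame, Matrix.mul_apply, sum_inner, real_inner_smul_left]

theorem crossGram_changeFrame_right [Fintype κ] (A : Matrix ι κ ℝ) (a : κ → E) (b : η → E) :
    crossGram b (changeFrame A a) = crossGram b a * Aᵀ := by
  rw [← crossGram_transpose, crossGram_changeFrame_left, Matrix.transpose_mul, crossGram_transpose]

theorem exists_eq_changeFrame_add_orthogonal [Fintype ι] (a : ι → E) (b : κ → E) :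
    ∃ (W : Matrix κ ι ℝ) (c : κ → E), b = changeFrame W a + c ∧ crossGram a c = 0 ∧
      ∀ i, ∀ v ∈ Submodule.span ℝ (range a), ‖c i‖ ≤ ‖b i - v‖ := by
  set K := Submodule.span ℝ (range a)
  have : FiniteDimensional ℝ K := FiniteDimensional.span_of_finite ℝ (finite_range a)
  obtain ⟨W, hW⟩ := exists_eq_changeFrame fun i => K.starProjection_apply_mem (b i)
  refine ⟨W, fun i => b i - K.starProjection (b i), ?_, ?_, fun i v hv => ?_⟩
  · rw [← hW]
    ext1 i
    simp
  · ext i j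
    exact Submodule.inner_right_of_mem_orthogonal (Submodule.subset_span (mem_range_self i))
      (K.sub_starProjection_mem_orthogonal (b j))
  · rw [K.starProjection_minimal]
    exact ciInf_le (f := fun w : K => ‖b i - w‖) ⟨0, forall_mem_range.2 fun w => norm_nonneg _⟩
      ⟨v, hv⟩

variable [Fintype ι] [DecidableEq ι]

theorem det_crossGram_self_pos {a : ι → E} (ha : LinearIndependent ℝ a) :
    0 < (crossGram a a).det :=
  (Matrix.posDef_gram_of_linearIndependent (𝕜 := ℝ) ha).det_pos

theorem linearIndependent_of_det_crossGram_self_ne_zero {a : ι → E}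
    (ha : (crossGram a a).det ≠ 0) : LinearIndependent ℝ a :=
  Matrix.det_gram_ne_zero_iff_linearIndependent.1 ha

theorem frameCos_comm (a b : ι → E) : frameCos a b = frameCos b a := by
  rw [frameCos, frameCos, mul_comm, ← crossGram_transpose, Matrix.det_transpose]

theorem frameCos_changeFrame_left (A : Matrix ι ι ℝ) (a b : ι → E) :
    frameCos (changeFrame A a) b = SignType.sign A.det * frameCos a b := by
  have hsqrt : √(crossGram (changeFrame A a) (changeFrame A a)).det =
      |A.det| * √(crossGram a a).det := by
    rw [crossGram_changeFrame_left, crossGram_changeFrame_right, Matrix.det_mul, Matrix.det_mul,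
      Matrix.det_transpose, mul_left_comm, mul_comm, ← sq, Real.sqrt_mul (sq_nonneg _),
      Real.sqrt_sq_eq_abs]
  rcases eq_or_ne A.det 0 with h | h
  · simp [frameCos, crossGram_changeFrame_left, h]
  · rw [frameCos, hsqrt, crossGram_changeFrame_left, Matrix.det_mul, frameCos, mul_assoc,
      mul_div_mul_comm]
    congr 1
    rw [div_eq_iff (abs_ne_zero.2 h), sign_mul_abs]

theorem frameCos_changeFrame_right (A : Matrix ι ι ℝ) (a b : ι → E) :
    frameCos a (changeFrame A b) = SignType.sign A.det * frameCos a b := by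
  rw [frameCos_comm, frameCos_changeFrame_left, frameCos_comm]

theorem frameCos_eq_det {a b : ι → E} (ha : Orthonormal ℝ a) (hb : Orthonormal ℝ b) :
    frameCos a b = (crossGram a b).det := by
  simp [frameCos, crossGram_self_eq_one_iff.2 ha, crossGram_self_eq_one_iff.2 hb]

theorem frameCos_self {a : ι → E} (ha : LinearIndependent ℝ a) : frameCos a a = 1 := by
  have h := det_crossGram_self_pos ha
  rw [frameCos, Real.mul_self_sqrt h.le, div_self h.ne']

theorem tendsto_frameCos {α : Type*} {l : Filter α} {a b : α → ι → E} {a₀ b₀ : ι → E}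
    (ha : Tendsto a l (𝓝 a₀)) (hb : Tendsto b l (𝓝 b₀)) (ha₀ : LinearIndependent ℝ a₀)
    (hb₀ : LinearIndependent ℝ b₀) :
    Tendsto (fun x => frameCos (a x) (b x)) l (𝓝 (frameCos a₀ b₀)) := by
  have hdet {u v : α → ι → E} {u₀ v₀ : ι → E} (hu : Tendsto u l (𝓝 u₀))
      (hv : Tendsto v l (𝓝 v₀)) :
      Tendsto (fun x => (crossGram (u x) (v x)).det) l (𝓝 (crossGram u₀ v₀).det) :=
    (continuous_crossGram.matrix_det.tendsto (u₀, v₀)).comp (hu.prodMk_nhds hv)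
  refine (hdet ha hb).div ((hdet ha ha).sqrt.mul (hdet hb hb).sqrt) (mul_ne_zero ?_ ?_)
  · exact (Real.sqrt_pos.2 (det_crossGram_self_pos ha₀)).ne'
  · exact (Real.sqrt_pos.2 (det_crossGram_self_pos hb₀)).ne'

theorem orthonormal_changeFrame {A : Matrix ι ι ℝ} (hA : A * Aᵀ = 1) {a : ι → E}
    (ha : Orthonormal ℝ a) : Orthonormal ℝ (changeFrame A a) := by
  rw [← crossGram_self_eq_one_iff] at ha ⊢
  rw [crossGram_changeFrame_left, crossGram_changeFrame_right, ha, Matrix.one_mul, hA]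

theorem exists_orthonormal_changeFrame {a : ι → E} (ha : LinearIndependent ℝ a) :
    ∃ A : Matrix ι ι ℝ, A.det ≠ 0 ∧ Orthonormal ℝ (changeFrame A a) := by
  have : FiniteDimensional ℝ (Submodule.span ℝ (range a)) :=
    FiniteDimensional.span_of_finite ℝ (finite_range a)
  have hcard : Fintype.card (Fin (Module.finrank ℝ (Submodule.span ℝ (range a)))) =
      Fintype.card ι := by
    rw [finrank_span_eq_card ha, Fintype.card_fin]
  let e := (stdOrthonormalBasis ℝ (Submodule.span ℝ (range a))).reindex
    (Fintype.equivOfCardEq hcard)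
  have he : Orthonormal ℝ fun i => (e i : E) :=
    e.orthonormal.comp_linearIsometry (Submodule.span ℝ (range a)).subtypeₗᵢ
  obtain ⟨A, hA⟩ := exists_eq_changeFrame fun i => (e i).2
  rw [hA] at he
  refine ⟨A, fun h => ?_, he⟩
  have hdet := congrArg Matrix.det (crossGram_self_eq_one_iff.2 he)
  simp [crossGram_changeFrame_left, h] at hdet

theorem exists_orthonormal_changeFrame_of_sign [Nonempty ι] {a : ι → E}
    (ha : LinearIndependent ℝ a) {s : ℝ} (hs : s ≠ 0) :
    ∃ A : Matrix ι ι ℝ, 0 < s * A.det ∧ Orthonormal ℝ (changeFrame A a) := by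
  obtain ⟨A, hA, hortho⟩ := exists_orthonormal_changeFrame ha
  rcases (mul_ne_zero hs hA).lt_or_gt with hneg | hpos
  · let i₀ : ι := Classical.arbitrary ι
    let F : Matrix ι ι ℝ := Matrix.diagonal (Function.update 1 i₀ (-1))
    have hFdet : F.det = -1 := by
      simp [F, Matrix.det_diagonal, Finset.prod_update_of_mem]
    have hF : F * Fᵀ = 1 := by
      rw [Matrix.diagonal_transpose, Matrix.diagonal_mul_diagonal, ← Matrix.diagonal_one]
      congr 1 with i
      rcases eq_or_ne i i₀ with rfl | h <;> simp [*]
    refine ⟨F * A, ?_, changeFrame_changeFrame F A a ▸ orthonormal_changeFrame hF hortho⟩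
    rw [Matrix.det_mul, hFdet]
    linarith
  · exact ⟨A, hpos, hortho⟩

theorem det_crossGram_sq_of_orthogonal {a b c : ι → E} {W : Matrix ι ι ℝ}
    (hb : b = changeFrame W a + c) (hc : crossGram a c = 0) :
    (crossGram a b).det ^ 2 = (crossGram a a).det * (crossGram b b - crossGram c c).det := by
  have hca : crossGram c a = 0 := by rw [← crossGram_transpose, hc, Matrix.transpose_zero]
  have hab : crossGram a b = crossGram a a * Wᵀ := by
    rw [hb, crossGram_add_right, hc, crossGram_changeFrame_right, add_zero]
  have hbb : crossGram b b - crossGram c c = W * (crossGram a a * Wᵀ) := by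
    simp only [hb, crossGram_add_left, crossGram_add_right, crossGram_changeFrame_left,
      crossGram_changeFrame_right, hc, hca, Matrix.mul_zero, add_zero, zero_add,
      add_sub_cancel_right, Matrix.mul_assoc]
  rw [hab, hbb, Matrix.det_mul, Matrix.det_mul, Matrix.det_mul, Matrix.det_transpose]
  ring

theorem one_sub_frameCos_sq_of_orthogonal {a b c : ι → E} {W : Matrix ι ι ℝ}
    (ha : LinearIndependent ℝ a) (hb : LinearIndependent ℝ b) (hbc : b = changeFrame W a + c)
    (hc : crossGram a c = 0) :
    1 - frameCos a b ^ 2 =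
      ((crossGram b b).det - (crossGram b b - crossGram c c).det) / (crossGram b b).det := by
  have hda := det_crossGram_self_pos ha
  have hdb := det_crossGram_self_pos hb
  rw [frameCos, div_pow, mul_pow, Real.sq_sqrt hda.le, Real.sq_sqrt hdb.le,
    det_crossGram_sq_of_orthogonal hbc hc, mul_div_mul_left _ _ hda.ne', sub_div, div_self hdb.ne']

theorem isBigO_det_sub_det {α : Type*} {l : Filter α} {A B : α → Matrix ι ι ℝ}
    {A₀ : Matrix ι ι ℝ} {g : α → ℝ} (hA : Tendsto A l (𝓝 A₀)) (hB : Tendsto B l (𝓝 A₀))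
    (hAB : ∀ i j, (fun x => A x i j - B x i j) =O[l] g) :
    (fun x => (A x).det - (B x).det) =O[l] g := by
  let f (M : ι → ι → ℝ) : ℝ := (Matrix.of M).det
  have hf : ContDiff ℝ 1 f := by
    simp only [f, Matrix.det_apply, Matrix.of_apply]
    fun_prop
  have hstrict : HasStrictFDerivAt f _ (Matrix.of.symm A₀) :=
    hf.contDiffAt.hasStrictFDerivAt one_ne_zero
  refine (hstrict.isBigO_sub.comp_tendsto (hA.prodMk_nhds hB)).trans ?_
  exact isBigO_pi.2 fun i => isBigO_pi.2 fun j => hAB i j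

theorem isBigO_one_sub_frameCos_sq {α : Type*} {l : Filter α} {a b v : α → ι → E} {b₀ : ι → E}
    {δ : α → ℝ} (ha : ∀ᶠ x in l, LinearIndependent ℝ (a x)) (hb : Tendsto b l (𝓝 b₀))
    (hb₀ : LinearIndependent ℝ b₀) (hv : ∀ x i, v x i ∈ Submodule.span ℝ (range (a x)))
    (hbv : ∀ i, (fun x => b x i - v x i) =O[l] δ) (hδ : Tendsto δ l (𝓝 0)) :
    (fun x => 1 - frameCos (a x) (b x) ^ 2) =O[l] fun x => δ x ^ 2 := by
  choose W c hbc hac hmin using fun x => exists_eq_changeFrame_add_orthogonal (a x) (b x)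
  have hcδ (i : ι) : (fun x => c x i) =O[l] δ :=
    (IsBigO.of_norm_le fun x => hmin x i _ (hv x i)).trans (hbv i).norm_left
  have hc : Tendsto c l (𝓝 0) := tendsto_pi_nhds.2 fun i => (hcδ i).trans_tendsto hδ
  have hG {u : α → ι → E} {u₀ : ι → E} (hu : Tendsto u l (𝓝 u₀)) :
      Tendsto (fun x => crossGram (u x) (u x)) l (𝓝 (crossGram u₀ u₀)) :=
    (continuous_crossGram.tendsto (u₀, u₀)).comp (hu.prodMk_nhds hu)
  have hGb := hG hb
  have hdet : Tendsto (fun x => (crossGram (b x) (b x)).det) l (𝓝 (crossGram b₀ b₀).det) :=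
    (continuous_id.matrix_det.tendsto _).comp hGb
  have hdet₀ := (det_crossGram_self_pos hb₀).ne'
  have hGbc : Tendsto (fun x => crossGram (b x) (b x) - crossGram (c x) (c x)) l
      (𝓝 (crossGram b₀ b₀)) := by
    have h0 : crossGram (0 : ι → E) (0 : ι → E) = 0 := by ext; simp [crossGram]
    simpa only [h0, sub_zero] using hGb.sub (hG hc)
  have hnum : (fun x => (crossGram (b x) (b x)).det -
      (crossGram (b x) (b x) - crossGram (c x) (c x)).det) =O[l] fun x => δ x ^ 2 := by
    refine isBigO_det_sub_det hGb hGbc fun i j => ?_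
    simp only [Matrix.sub_apply, sub_sub_cancel, sq]
    refine IsBigO.trans (IsBigO.of_bound' (Eventually.of_forall fun x => ?_))
      ((hcδ i).norm_left.mul (hcδ j).norm_left)
    rw [norm_mul, norm_norm, norm_norm]
    exact norm_inner_le_norm _ _
  have hquot := hnum.mul ((hdet.inv₀ hdet₀).isBigO_one ℝ)
  refine hquot.congr' ?_ (Eventually.of_forall fun x => mul_one _)
  filter_upwards [ha, hdet.eventually_ne hdet₀] with x hax hbx
  rw [one_sub_frameCos_sq_of_orthogonal hax (linearIndependent_of_det_crossGram_self_ne_zero hbx)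
    (hbc x) (hac x), div_eq_mul_inv]

end Frames

/-! ### Reflections and sphere frames -/

section Reflections

variable {E : Type*} [NormedAddCommGroup E] [InnerProductSpace ℝ E]

/-- The reflection in the hyperplane orthogonal to `z`. It maps the tangent space at `x` of a sphere
through `x` and `x + z` to the one at `x + z`. It is the identity for `z = 0`. -/
def normalReflection (z : E) : E ≃ₗᵢ[ℝ] E :=
  (ℝ ∙ z)ᗮ.reflection

theorem normalReflection_apply (z v : E) :
    normalReflection z v = v - (2 * (⟪z, v⟫_ℝ / ‖z‖ ^ 2)) • z := by
  rw [normalReflection, Submodule.reflection_orthogonal_apply, Submodule.reflection_singleton_apply]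
  simp only [RCLike.ofReal_real_eq_id, id, neg_sub, mul_smul]
  norm_num [two_smul]

theorem normalReflection_smul {r : ℝ} (hr : r ≠ 0) (z : E) :
    normalReflection (r • z) = normalReflection z := by
  unfold normalReflection
  congr 2
  exact Submodule.span_singleton_smul_eq hr.isUnit z

theorem normalReflection_sub {v w : E} (h : ‖v‖ = ‖w‖) : normalReflection (w - v) v = w := by
  rw [← neg_sub v w, ← neg_one_smul ℝ (v - w), normalReflection_smul (by norm_num)]
  exact Submodule.reflection_sub h

theorem normalReflection_comp_comp {ι : Type*} (z : E) (a : ι → E) :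
    normalReflection z ∘ normalReflection z ∘ a = a :=
  funext fun _ => Submodule.reflection_reflection _ _

theorem linearIndependent_normalReflection_comp {ι : Type*} {a : ι → E}
    (ha : LinearIndependent ℝ a) (z : E) : LinearIndependent ℝ (normalReflection z ∘ a) :=
  ha.map' (normalReflection z).toLinearEquiv.toLinearMap (LinearEquiv.ker _)

theorem tendsto_normalReflection_comp {ι α : Type*} {l : Filter α} {z : α → E} {z₀ : E}
    {a : α → ι → E} {a₀ : ι → E} (hz : Tendsto z l (𝓝 z₀)) (hz₀ : z₀ ≠ 0)
    (ha : Tendsto a l (𝓝 a₀)) :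
    Tendsto (fun x => normalReflection (z x) ∘ a x) l (𝓝 (normalReflection z₀ ∘ a₀)) := by
  refine tendsto_pi_nhds.2 fun i => ?_
  have hai := tendsto_pi_nhds.1 ha i
  simp only [Function.comp_apply, normalReflection_apply]
  exact hai.sub ((((hz.inner hai).div (hz.norm.pow 2) (by simpa using hz₀)).const_mul 2).smul hz)

theorem exists_normalReflection_comp_eq_changeFrame {ι : Type*} [Fintype ι] [DecidableEq ι] {z : E}
    (hz : z ≠ 0) {a : ι → E} (h : z ∈ Submodule.span ℝ (range a)) :
    ∃ W : Matrix ι ι ℝ, W.det = -1 ∧ normalReflection z ∘ a = changeFrame W a := by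
  obtain ⟨t, ht⟩ := (Submodule.mem_span_range_iff_exists_fun ℝ).1 h
  let s (i : ι) : ℝ := 2 * (⟪z, a i⟫_ℝ / ‖z‖ ^ 2)
  have hts : t ⬝ᵥ s = 2 := by
    have hz2 : ∑ i, t i * ⟪z, a i⟫_ℝ = ‖z‖ ^ 2 := by
      rw [← real_inner_self_eq_norm_sq]
      simp_rw [← real_inner_smul_right, ← inner_sum, ht]
    simp_rw [dotProduct, s, mul_left_comm _ (2 : ℝ), ← mul_div_assoc, ← Finset.sum_div,
      ← Finset.mul_sum, hz2]
    exact mul_div_cancel_right₀ _ (by simpa using hz)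
  refine ⟨1 - Matrix.vecMulVec s t, ?_, ?_⟩
  · have hdet := Matrix.det_one_add_replicateCol_mul_replicateRow (ι := Unit) (-s) t
    rw [← Matrix.vecMulVec_eq, Matrix.neg_vecMulVec, ← sub_eq_add_neg, dotProduct_neg, hts] at hdet
    rw [hdet]
    norm_num
  · ext1 i
    simp only [Function.comp_apply, normalReflection_apply, changeFrame, Matrix.sub_apply, sub_smul,
      Finset.sum_sub_distrib, Matrix.one_apply, ite_smul, one_smul, zero_smul, Finset.sum_ite_eq,
      Finset.mem_univ, if_true, Matrix.vecMulVec_apply, mul_smul (s i), ← Finset.smul_sum, ht]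
    rfl

theorem exists_changeFrame_cons_iff {d : ℕ} {w : E} (hw : w ≠ 0) {a u : Fin d → E}
    (ha : ∀ i, ⟪a i, w⟫_ℝ = 0) (hu : ∀ i, ⟪u i, w⟫_ℝ = 0) {r : ℝ} :
    (∃ Q : Matrix (Fin (d + 1)) (Fin (d + 1)) ℝ, Q.det = r ∧
      (Fin.cons w u : Fin (d + 1) → E) = changeFrame Q (Fin.cons w a)) ↔
    ∃ C : Matrix (Fin d) (Fin d) ℝ, C.det = r ∧ u = changeFrame C a := by
  constructor
  · rintro ⟨Q, rfl, hQ⟩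
    have hw2 : ⟪w, w⟫_ℝ ≠ 0 := inner_self_ne_zero.2 hw
    have hcol (i) : ⟪(Fin.cons w u : Fin (d + 1) → E) i, w⟫_ℝ = Q i 0 * ⟪w, w⟫_ℝ := by
      simp [hQ, changeFrame, Fin.sum_univ_succ, inner_add_left, sum_inner, real_inner_smul_left, ha]
    have h0 : Q 0 0 = 1 := by
      have := hcol 0
      rwa [Fin.cons_zero, eq_comm, mul_eq_right₀ hw2] at this
    have hsucc (i : Fin d) : Q i.succ 0 = 0 := by
      have := hcol i.succ
      rw [Fin.cons_succ, hu, eq_comm] at this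
      exact (mul_eq_zero.1 this).resolve_right hw2
    refine ⟨Q.submatrix Fin.succ Fin.succ, ?_, funext fun i => ?_⟩
    · simp [Matrix.det_succ_column_zero Q, Fin.sum_univ_succ, h0, hsucc]
    · simpa [hsucc, changeFrame, Fin.sum_univ_succ] using congrFun hQ i.succ
  · rintro ⟨C, rfl, rfl⟩
    refine ⟨Matrix.of (Fin.cons (Fin.cons 1 fun _ => 0) fun i => Fin.cons 0 (C i)), ?_, ?_⟩
    · rw [Matrix.det_succ_column_zero, Fin.sum_univ_succ]
      simp
      rfl
    · ext1 i
      refine Fin.cases ?_ (fun i => ?_) i <;> simp [changeFrame, Fin.sum_univ_succ]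

/-- The witness is `-(‖z‖² / (2‖p‖²)) p`, where `p` is the component of `z` orthogonal to the span
of `s`; the sphere with centre `-w` through `0` is tangent to that span at `0` and passes through
`z`. -/
theorem exists_mem_orthogonal_norm_eq {s : Set E} [FiniteDimensional ℝ (Submodule.span ℝ s)] {z : E}
    (hz : z ∉ Submodule.span ℝ s) :
    ∃ w ∈ (Submodule.span ℝ s)ᗮ, w ≠ 0 ∧ ‖w‖ = ‖z + w‖ ∧ z ∈ Submodule.span ℝ (insert w s) := by
  set K := Submodule.span ℝ s
  set p := z - K.starProjection z with hp
  have hpK : p ∈ Kᗮ := K.sub_starProjection_mem_orthogonal z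
  have hzp : z = p + K.starProjection z := by rw [hp, sub_add_cancel]
  have hz0 : z ≠ 0 := fun h => hz (h ▸ K.zero_mem)
  have hp0 : p ≠ 0 := fun h =>
    hz (by rw [hzp, h, zero_add]; exact K.starProjection_apply_mem z)
  have hinner : ⟪z, p⟫_ℝ = ‖p‖ ^ 2 := by
    rw [hzp, inner_add_left, K.inner_right_of_mem_orthogonal (K.starProjection_apply_mem z) hpK,
      add_zero, real_inner_self_eq_norm_sq]
  have hr : -(‖z‖ ^ 2 / (2 * ‖p‖ ^ 2)) ≠ 0 := by
    have := norm_pos_iff.2 hz0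
    have := norm_pos_iff.2 hp0
    exact neg_ne_zero.2 (by positivity)
  refine ⟨-(‖z‖ ^ 2 / (2 * ‖p‖ ^ 2)) • p, Kᗮ.smul_mem _ hpK, smul_ne_zero hr hp0, ?_, ?_⟩
  · have := norm_ne_zero_iff.2 hp0
    rw [← sq_eq_sq₀ (norm_nonneg _) (norm_nonneg _), norm_add_sq_real,
      real_inner_smul_right, hinner]
    field_simp
    ring
  · rw [Submodule.span_insert, Submodule.span_singleton_smul_eq hr.isUnit]
    exact Submodule.mem_sup.2 ⟨p, Submodule.mem_span_singleton_self p, _,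
      K.starProjection_apply_mem z, hzp.symm⟩

end Reflections

section SphereFrames

variable {n d : ℕ} {x y : Euc n}

theorem sameOrientation_iff_normalReflection {z : Euc n} (hz : z ≠ 0) {a u : Fin d → Euc n}
    (h : z ∈ Submodule.span ℝ (range a)) :
    SameOrientation a u ↔
      ∃ C : Matrix (Fin d) (Fin d) ℝ, C.det < 0 ∧ u = changeFrame C (normalReflection z ∘ a) := by
  obtain ⟨W, hW, hWa⟩ := exists_normalReflection_comp_eq_changeFrame hz h
  have hWR : a = changeFrame W (normalReflection z ∘ a) := by
    rw [← comp_changeFrame, ← hWa, normalReflection_comp_comp]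
  rw [sameOrientation_iff]
  constructor
  · rintro ⟨A, hA, rfl⟩
    refine ⟨A * W, by rw [Matrix.det_mul, hW]; linarith, ?_⟩
    rw [← changeFrame_changeFrame, ← hWR]
  · rintro ⟨C, hC, rfl⟩
    exact ⟨C * W, by rw [Matrix.det_mul, hW]; linarith, by rw [← changeFrame_changeFrame, ← hWa]⟩

theorem sameOrientation_cons_iff_normalReflection {c : Euc n} (hxy : y - x ≠ 0) (hcx : c ≠ x)
    {e u : Fin d → Euc n} (he : ∀ i, ⟪e i, x - c⟫_ℝ = 0) (hdist : dist y c = dist x c)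
    (hspan : y - c ∈ Submodule.span ℝ (insert (x - c) (range e)))
    (hu : ∀ i, ⟪u i, y - c⟫_ℝ = 0) :
    SameOrientation (Fin.cons (x - c) e : Fin (d + 1) → Euc n) (Fin.cons (y - c) u) ↔
      ∃ C : Matrix (Fin d) (Fin d) ℝ,
        C.det < 0 ∧ u = changeFrame C (normalReflection (y - x) ∘ e) := by
  have hR : normalReflection (y - x) (x - c) = y - c := by
    rw [← sub_sub_sub_cancel_right y x c]
    exact normalReflection_sub (by rw [← dist_eq_norm, ← dist_eq_norm, hdist])
  have hyc : y - c ≠ 0 := by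
    rw [sub_ne_zero, ← dist_ne_zero, hdist, dist_ne_zero]
    exact hcx.symm
  have hmem : y - x ∈ Submodule.span ℝ (range (Fin.cons (x - c) e : Fin (d + 1) → Euc n)) := by
    rw [Fin.range_cons, ← sub_sub_sub_cancel_right y x c]
    exact Submodule.sub_mem _ hspan (Submodule.subset_span (mem_insert _ _))
  have hcons : normalReflection (y - x) ∘ (Fin.cons (x - c) e : Fin (d + 1) → Euc n) =
      Fin.cons (y - c) (normalReflection (y - x) ∘ e) := by
    rw [← hR]
    exact Fin.comp_cons _ _ _
  have he' (i : Fin d) : ⟪(normalReflection (y - x) ∘ e) i, y - c⟫_ℝ = 0 := by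
    rw [← hR, Function.comp_apply, LinearIsometryEquiv.inner_map_map, he]
  rw [sameOrientation_iff_normalReflection hxy hmem, hcons]
  constructor
  · rintro ⟨Q, hQ, h⟩
    obtain ⟨C, hC, hCu⟩ := (exists_changeFrame_cons_iff hyc he' hu).1 ⟨Q, rfl, h⟩
    exact ⟨C, hC ▸ hQ, hCu⟩
  · rintro ⟨C, hC, h⟩
    obtain ⟨Q, hQ, hQu⟩ := (exists_changeFrame_cons_iff hyc he' hu).2 ⟨C, rfl, h⟩
    exact ⟨Q, hQ ▸ hC, hQu⟩

/-- The determinant is negative because the reflection maps the outward normal of the sphere at `x`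
to the outward normal at `y`, while it reverses the orientation of the ambient `(d + 1)`-space. -/
theorem isSphereFrame_iff (hxy : y - x ≠ 0) {e u : Fin d → Euc n} :
    IsSphereFrame x y e u ↔
      ∃ C : Matrix (Fin d) (Fin d) ℝ,
        C.det < 0 ∧ u = changeFrame C (normalReflection (y - x) ∘ e) := by
  constructor
  · rintro (⟨hspan, hor⟩ | ⟨c, hcx, he, hdist, hspan, hu, hor⟩)
    · exact (sameOrientation_iff_normalReflection hxy hspan).1 hor
    · exact (sameOrientation_cons_iff_normalReflection hxy hcx he hdist hspan hu).1 hor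
  intro hC
  by_cases hspan : y - x ∈ Submodule.span ℝ (range e)
  · exact Or.inl ⟨hspan, (sameOrientation_iff_normalReflection hxy hspan).2 hC⟩
  obtain ⟨w, hw, hw0, hnorm, hmem⟩ := exists_mem_orthogonal_norm_eq hspan
  obtain ⟨c, hxc⟩ : ∃ c, x - c = w := ⟨x - w, sub_sub_cancel x w⟩
  have hyc : y - c = y - x + w := by rw [← hxc, sub_add_sub_cancel]
  have hcx : c ≠ x := by rwa [ne_comm, ← sub_ne_zero, hxc]
  have hdist : dist y c = dist x c := by rw [dist_eq_norm, dist_eq_norm, hxc, hyc, hnorm]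
  have he (i : Fin d) : ⟪e i, x - c⟫_ℝ = 0 :=
    hxc ▸ Submodule.inner_right_of_mem_orthogonal (Submodule.subset_span (mem_range_self i)) hw
  have hsphere : y - c ∈ Submodule.span ℝ (insert (x - c) (range e)) := by
    rw [hyc, hxc]
    exact Submodule.add_mem _ hmem (Submodule.subset_span (mem_insert _ _))
  have hu (i : Fin d) : ⟪u i, y - c⟫_ℝ = 0 := by
    obtain ⟨C, -, rfl⟩ := hC
    have hR : normalReflection (y - x) w = y - x + w := by
      simpa only [add_sub_cancel_right] using normalReflection_sub hnorm
    rw [hyc, ← hR, ← comp_changeFrame, Function.comp_apply, LinearIsometryEquiv.inner_map_map,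
      changeFrame, sum_inner]
    simp only [real_inner_smul_left, ← hxc, he, mul_zero, Finset.sum_const_zero]
  exact Or.inr ⟨c, hcx, he, hdist, hsphere, hu,
    (sameOrientation_cons_iff_normalReflection hxy hcx he hdist hsphere hu).2 hC⟩

end SphereFrames

/-! ### The combined angle of two frames -/

section CombinedCos

variable {E : Type*} [NormedAddCommGroup E] [InnerProductSpace ℝ E]
  {ι : Type*} [Fintype ι] [DecidableEq ι]

/-- The cosine of the combined angle at two points with difference `z` and with tangent spaces
oriented by the frames `a` and `b`. -/
def combinedCos (z : E) (a b : ι → E) : ℝ :=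
  -frameCos (normalReflection z ∘ a) b

theorem combinedCos_smul {r : ℝ} (hr : r ≠ 0) (z : E) (a b : ι → E) :
    combinedCos (r • z) a b = combinedCos z a b := by
  rw [combinedCos, normalReflection_smul hr, combinedCos]

theorem combinedCos_self {z : E} (hz : z ≠ 0) {a : ι → E} (ha : LinearIndependent ℝ a)
    (h : z ∈ Submodule.span ℝ (range a)) : combinedCos z a a = 1 := by
  obtain ⟨W, hW, hWa⟩ := exists_normalReflection_comp_eq_changeFrame hz h
  simp [combinedCos, hWa, frameCos_changeFrame_left, hW, frameCos_self ha]

theorem tendsto_combinedCos {α : Type*} {l : Filter α} {z : α → E} {z₀ : E} {a b : α → ι → E}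
    {a₀ b₀ : ι → E} (hz : Tendsto z l (𝓝 z₀)) (hz₀ : z₀ ≠ 0) (ha : Tendsto a l (𝓝 a₀))
    (hb : Tendsto b l (𝓝 b₀)) (ha₀ : LinearIndependent ℝ a₀) (hb₀ : LinearIndependent ℝ b₀) :
    Tendsto (fun x => combinedCos (z x) (a x) (b x)) l (𝓝 (combinedCos z₀ a₀ b₀)) :=
  (tendsto_frameCos (tendsto_normalReflection_comp hz hz₀ ha) hb
    (linearIndependent_normalReflection_comp ha₀ z₀) hb₀).neg

theorem IsCosCombinedAngle.eq_combinedCos {m n : ℕ} {T : Euc n → Set (Fin m → Euc n)} {x y : Euc n}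
    (hxy : y - x ≠ 0) {a b : Fin m → Euc n} (ha : ∀ e ∈ T x, SameOrientation a e)
    (hb : ∀ e ∈ T y, SameOrientation b e) {r : ℝ} (h : IsCosCombinedAngle T x y r) :
    r = combinedCos (y - x) a b := by
  obtain ⟨e, he, u, hsphere, hu, v, hv, hv', rfl⟩ := h
  obtain ⟨A, hA, rfl⟩ := sameOrientation_iff.1 (ha e he)
  obtain ⟨B, hB, rfl⟩ := sameOrientation_iff.1 (hb v hv)
  obtain ⟨C, hC, rfl⟩ := (isSphereFrame_iff hxy).1 hsphere
  refine (frameCos_eq_det hu hv').symm.trans ?_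
  rw [comp_changeFrame, frameCos_changeFrame_left, frameCos_changeFrame_left,
    frameCos_changeFrame_right, sign_neg hC, sign_pos hA, sign_pos hB, combinedCos]
  simp

theorem cosCombinedAngle_eq_combinedCos {m n : ℕ} (hm : 1 ≤ m) {T : Euc n → Set (Fin m → Euc n)}
    {x y : Euc n} (hxy : y - x ≠ 0) {a b : Fin m → Euc n} (ha : ∀ e, e ∈ T x ↔ SameOrientation a e)
    (hb : ∀ e, e ∈ T y ↔ SameOrientation b e) (hla : LinearIndependent ℝ a)
    (hlb : LinearIndependent ℝ b) : cosCombinedAngle T x y = combinedCos (y - x) a b := by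
  refine IsCosCombinedAngle.eq_combinedCos hxy (fun e => (ha e).1) (fun e => (hb e).1) ?_
  refine Classical.epsilon_spec (p := IsCosCombinedAngle T x y) ?_
  have : Nonempty (Fin m) := ⟨⟨0, hm⟩⟩
  obtain ⟨C, hC, hu⟩ := exists_orthonormal_changeFrame_of_sign
    (linearIndependent_normalReflection_comp hla (y - x)) (neg_ne_zero.2 one_ne_zero)
  obtain ⟨B, hB, hv⟩ := exists_orthonormal_changeFrame_of_sign hlb one_ne_zero
  have haa : SameOrientation a a := sameOrientation_iff.2 ⟨1, by simp, (changeFrame_one a).symm⟩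
  have hbv : SameOrientation b (changeFrame B b) := sameOrientation_iff.2 ⟨B, by linarith, rfl⟩
  exact ⟨_, a, (ha a).2 haa, _, (isSphereFrame_iff hxy).2 ⟨C, by linarith, rfl⟩, hu, _,
    (hb _).2 hbv, hv, rfl⟩

end CombinedCos

/-! ### The combined angle of nearby frames -/

section NearbyFrames

variable {E : Type*} [NormedAddCommGroup E] [InnerProductSpace ℝ E]
  {ι : Type*} [Fintype ι] [DecidableEq ι] {α : Type*} {l : Filter α}
  {z : α → E} {a b : α → ι → E} {a₀ : ι → E} {t : α → ι → ℝ}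

/-- Along an ultrafilter, the unit vectors `‖z‖⁻¹ • z` converge to a vector in the span of `a₀`,
where the combined angle vanishes. -/
theorem tendsto_combinedCos_one (ha : Tendsto a l (𝓝 a₀)) (hb : Tendsto b l (𝓝 a₀))
    (ha₀ : LinearIndependent ℝ a₀) (hz : ∀ᶠ x in l, z x ≠ 0) (ht : t =O[l] z)
    (hzt : (fun x => z x - ∑ i, t x i • a x i) =o[l] z) :
    Tendsto (fun x => combinedCos (z x) (a x) (b x)) l (𝓝 1) := by
  refine tendsto_iff_ultrafilter _ _ _ |>.2 fun g hg => ?_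
  obtain ⟨C, hC⟩ := ht.bound
  have hmem : ∀ᶠ x in g, ‖z x‖⁻¹ • t x ∈ Metric.closedBall (0 : ι → ℝ) C := by
    filter_upwards [hg hC, hg hz] with x hx hzx
    rw [mem_closedBall_zero_iff, norm_smul, norm_inv, norm_norm,
      inv_mul_le_iff₀ (norm_pos_iff.2 hzx), mul_comm]
    exact hx
  obtain ⟨τ, -, hτ⟩ := (isCompact_closedBall (0 : ι → ℝ) C).ultrafilter_le_nhds
    (g.map fun x => ‖z x‖⁻¹ • t x) (le_principal_iff.2 hmem)
  have hτ' (i : ι) : Tendsto (fun x => ‖z x‖⁻¹ * t x i) g (𝓝 (τ i)) := tendsto_pi_nhds.1 hτ i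
  have hunit : Tendsto (fun x => ‖z x‖⁻¹ • z x) g (𝓝 (∑ i, τ i • a₀ i)) := by
    have hsum := tendsto_finsetSum Finset.univ fun i _ =>
      (hτ' i).smul (tendsto_pi_nhds.1 (ha.mono_left hg) i)
    have herr : Tendsto (fun x => ‖z x‖⁻¹ • (z x - ∑ i, t x i • a x i)) g (𝓝 0) := by
      refine tendsto_zero_iff_norm_tendsto_zero.2 ?_
      simpa only [norm_smul, norm_inv, norm_norm, ← div_eq_inv_mul] using
        (hzt.mono hg).norm_norm.tendsto_div_nhds_zero
    refine (add_zero (∑ i, τ i • a₀ i) ▸ hsum.add herr).congr fun x => ?_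
    simp only [smul_sub, Finset.smul_sum, smul_smul, add_sub_cancel]
  have hnorm : ‖∑ i, τ i • a₀ i‖ = 1 := by
    refine tendsto_nhds_unique_of_eventuallyEq hunit.norm tendsto_const_nhds ?_
    filter_upwards [hg hz] with x hx
    rw [norm_smul, norm_inv, norm_norm, inv_mul_cancel₀ (norm_ne_zero_iff.2 hx)]
  have hne : ∑ i, τ i • a₀ i ≠ 0 := norm_ne_zero_iff.1 (hnorm ▸ one_ne_zero)
  rw [← combinedCos_self hne ha₀
    ((Submodule.mem_span_range_iff_exists_fun ℝ).2 ⟨τ, rfl⟩)]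
  refine (tendsto_combinedCos hunit hne (ha.mono_left hg) (hb.mono_left hg) ha₀ ha₀).congr' ?_
  filter_upwards [hg hz] with x hx
  exact combinedCos_smul (inv_ne_zero (norm_ne_zero_iff.2 hx)) _ _ _

/-- The vector of the plane of `normalReflection z ∘ a` that is compared with `b i` is the
reflection of `a i - s • ∑ j, t j • a j`, since `normalReflection z (b i) = b i - s • z` for some
`s`. -/
theorem isBigO_one_sub_combinedCos_sq (ha : ∀ᶠ x in l, LinearIndependent ℝ (a x))
    (hb : Tendsto b l (𝓝 a₀)) (ha₀ : LinearIndependent ℝ a₀) (hz : Tendsto z l (𝓝 0))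
    (hba : ∀ i, (fun x => b x i - a x i) =O[l] z)
    (hzt : (fun x => z x - ∑ i, t x i • a x i) =O[l] fun x => ‖z x‖ ^ 2) :
    (fun x => 1 - combinedCos (z x) (a x) (b x) ^ 2) =O[l] fun x => ‖z x‖ ^ 2 := by
  let s (x : α) (i : ι) : ℝ := 2 * (⟪z x, b x i⟫_ℝ / ‖z x‖ ^ 2)
  let v (x : α) (i : ι) : E := normalReflection (z x) (a x i - s x i • ∑ j, t x j • a x j)
  have hs (i : ι) : (fun x => s x i) =O[l] fun x => ‖z x‖⁻¹ := by
    have hbi := (tendsto_pi_nhds.1 hb i).isBigO_one ℝ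
    refine IsBigO.trans (IsBigO.of_bound 2 (Eventually.of_forall fun x => ?_))
      (((isBigO_refl (fun x => ‖z x‖⁻¹) l).mul hbi.norm_left).congr_right fun x => mul_one _)
    rw [norm_mul, norm_div, norm_pow, norm_norm, norm_mul, norm_norm, norm_inv, norm_norm,
      Real.norm_ofNat]
    gcongr
    rcases eq_or_ne (z x) 0 with h | h
    · simp [h]
    rw [div_le_iff₀ (by positivity)]
    refine (norm_inner_le_norm _ _).trans_eq ?_
    have := norm_ne_zero_iff.2 h
    field_simp
  have hv (x : α) (i : ι) : v x i ∈ Submodule.span ℝ (range (normalReflection (z x) ∘ a x)) := by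
    rw [range_comp]
    refine Submodule.apply_mem_span_image_of_mem_span
      (normalReflection (z x)).toLinearEquiv.toLinearMap (Submodule.sub_mem _ ?_ ?_)
    · exact Submodule.subset_span (mem_range_self i)
    · exact Submodule.smul_mem _ _ ((Submodule.mem_span_range_iff_exists_fun ℝ).2 ⟨t x, rfl⟩)
  have hbv (i : ι) : (fun x => b x i - v x i) =O[l] fun x => ‖z x‖ := by
    have hsz : (fun x => s x i • (z x - ∑ j, t x j • a x j)) =O[l] fun x => ‖z x‖ := by
      refine ((hs i).smul hzt).congr_right fun x => ?_
      rw [smul_eq_mul, sq, ← mul_assoc, inv_mul_mul_self]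
    refine IsBigO.trans (.of_bound' (.of_forall fun x => le_of_eq ?_)) ((hba i).norm_right.sub hsz)
    rw [← (normalReflection (z x)).norm_map, map_sub]
    simp only [v, normalReflection, Submodule.reflection_reflection]
    rw [← normalReflection, normalReflection_apply, smul_sub]
    congr 1
    abel
  have hRa : ∀ᶠ x in l, LinearIndependent ℝ (normalReflection (z x) ∘ a x) :=
    ha.mono fun x hx => linearIndependent_normalReflection_comp hx (z x)
  simpa only [combinedCos, neg_sq] using
    isBigO_one_sub_frameCos_sq hRa hb ha₀ hv hbv (by simpa using hz.norm)

theorem isBigO_one_sub_combinedCos (ha : Tendsto a l (𝓝 a₀)) (ha₀ : LinearIndependent ℝ a₀)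
    (hz : Tendsto z l (𝓝 0)) (hz0 : ∀ᶠ x in l, z x ≠ 0)
    (hba : ∀ i, (fun x => b x i - a x i) =O[l] z) (ht : t =O[l] z)
    (hzt : (fun x => z x - ∑ i, t x i • a x i) =O[l] fun x => ‖z x‖ ^ 2) :
    (fun x => 1 - combinedCos (z x) (a x) (b x)) =O[l] fun x => ‖z x‖ ^ 2 := by
  have hb : Tendsto b l (𝓝 a₀) := tendsto_pi_nhds.2 fun i => by
    simpa using ((hba i).trans_tendsto hz).add (tendsto_pi_nhds.1 ha i)
  have hzo : (fun x => ‖z x‖ ^ 2) =o[l] z := by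
    refine IsLittleO.of_norm_right ?_
    simpa only [sq, one_mul] using
      ((isLittleO_one_iff ℝ).2 hz).norm_left.mul_isBigO (isBigO_refl (fun x => ‖z x‖) l)
  have hlim := tendsto_combinedCos_one ha hb ha₀ hz0 ht (hzt.trans_isLittleO hzo)
  have hali : ∀ᶠ x in l, LinearIndependent ℝ (a x) := ha.eventually ha₀.eventually
  refine IsBigO.trans (IsBigO.of_bound' ?_) (isBigO_one_sub_combinedCos_sq hali hb ha₀ hz hba hzt)
  filter_upwards [hlim.eventually_const_lt zero_lt_one] with x hx
  rw [← one_pow 2, sq_sub_sq, one_pow, norm_mul]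
  refine le_mul_of_one_le_left (norm_nonneg _) ?_
  rw [Real.norm_eq_abs]
  exact le_abs.2 (Or.inl (by linarith))

end NearbyFrames

/-! ### Families of maps with converging derivatives -/

section FamiliesOfMaps

variable {V F ι : Type*} [NormedAddCommGroup V] [NormedSpace ℝ V]
  [NormedAddCommGroup F] [NormedSpace ℝ F]
  {l : Filter ι} {g : ι → V → F} {x₀ : V} {A : V →L[ℝ] F} {A' : V →L[ℝ] V →L[ℝ] F}

theorem tendsto_nhds_prod_fst {X Y : Type*} [TopologicalSpace X] [TopologicalSpace Y] (x₀ : X)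
    (y₀ : Y) (l : Filter ι) :
    Tendsto (fun t : (X × Y) × ι => (t.1.1, t.2)) (𝓝 (x₀, y₀) ×ˢ l) (𝓝 x₀ ×ˢ l) :=
  continuousAt_fst.tendsto.prodMap tendsto_id

theorem tendsto_nhds_prod_snd {X Y : Type*} [TopologicalSpace X] [TopologicalSpace Y] (x₀ : X)
    (y₀ : Y) (l : Filter ι) :
    Tendsto (fun t : (X × Y) × ι => (t.1.2, t.2)) (𝓝 (x₀, y₀) ×ˢ l) (𝓝 y₀ ×ˢ l) :=
  continuousAt_snd.tendsto.prodMap tendsto_id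

theorem eventually_forall_segment {P : (V × V) × ι → Prop}
    (h : ∀ᶠ t in 𝓝 (x₀, x₀) ×ˢ l, P t) :
    ∀ᶠ t in 𝓝 (x₀, x₀) ×ˢ l, ∀ z ∈ segment ℝ t.1.1 t.1.2, P ((t.1.1, z), t.2) := by
  obtain ⟨r, hr, pb, hb, H⟩ := Metric.eventually_nhds_prod_iff.1 h
  refine Metric.eventually_nhds_prod_iff.2 ⟨r, hr, pb, hb, fun x hx i hi z hz => H ?_ hi⟩
  rw [← Metric.mem_ball, ← ball_prod_same] at hx ⊢
  exact ⟨hx.1, (convex_ball x₀ r).segment_subset hx.1 hx.2 hz⟩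

theorem isLittleO_sub_sub_of_tendsto_fderiv
    (hd : ∀ᶠ t in 𝓝 x₀ ×ˢ l, DifferentiableAt ℝ (g t.2) t.1)
    (hA : Tendsto (fun t : V × ι => fderiv ℝ (g t.2) t.1) (𝓝 x₀ ×ˢ l) (𝓝 A)) :
    (fun t : (V × V) × ι => g t.2 t.1.2 - g t.2 t.1.1 - A (t.1.2 - t.1.1))
      =o[𝓝 (x₀, x₀) ×ˢ l] fun t => t.1.2 - t.1.1 := by
  refine isLittleO_iff.2 fun ε hε => ?_
  have hnear := hd.and (hA.eventually (Metric.closedBall_mem_nhds A hε))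
  filter_upwards [eventually_forall_segment ((tendsto_nhds_prod_snd x₀ x₀ l).eventually hnear)]
    with t ht
  exact (convex_segment t.1.1 t.1.2).norm_image_sub_le_of_norm_fderiv_le'
    (fun z hz => (ht z hz).1) (fun z hz => mem_closedBall_iff_norm.1 (ht z hz).2)
    (left_mem_segment ℝ _ _) (right_mem_segment ℝ _ _)

theorem isBigO_sub_of_tendsto_fderiv
    (hd : ∀ᶠ t in 𝓝 x₀ ×ˢ l, DifferentiableAt ℝ (g t.2) t.1)
    (hA : Tendsto (fun t : V × ι => fderiv ℝ (g t.2) t.1) (𝓝 x₀ ×ˢ l) (𝓝 A)) :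
    (fun t : (V × V) × ι => g t.2 t.1.2 - g t.2 t.1.1)
      =O[𝓝 (x₀, x₀) ×ˢ l] fun t => t.1.2 - t.1.1 := by
  simpa only [sub_add_cancel] using
    (isLittleO_sub_sub_of_tendsto_fderiv hd hA).isBigO.add (A.isBigO_comp _ _)

theorem isBigO_sub_of_tendsto_fderiv_injective [FiniteDimensional ℝ V]
    (hd : ∀ᶠ t in 𝓝 x₀ ×ˢ l, DifferentiableAt ℝ (g t.2) t.1)
    (hA : Tendsto (fun t : V × ι => fderiv ℝ (g t.2) t.1) (𝓝 x₀ ×ˢ l) (𝓝 A))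
    (hinj : Function.Injective A) :
    (fun t : (V × V) × ι => t.1.2 - t.1.1)
      =O[𝓝 (x₀, x₀) ×ˢ l] fun t => g t.2 t.1.2 - g t.2 t.1.1 := by
  obtain ⟨K, -, hK⟩ := LinearMap.exists_antilipschitzWith (A : V →ₗ[ℝ] F)
    (LinearMap.ker_eq_bot.2 hinj)
  have hAO : (fun t : (V × V) × ι => t.1.2 - t.1.1)
      =O[𝓝 (x₀, x₀) ×ˢ l] fun t => A (t.1.2 - t.1.1) :=
    IsBigO.of_bound K (.of_forall fun t => hK.le_mul_norm (map_zero A) _)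
  have hlo := (isLittleO_sub_sub_of_tendsto_fderiv hd hA).trans_isBigO hAO
  refine hAO.trans (hlo.right_isBigO_add.congr_right fun t => ?_)
  exact sub_add_cancel _ _

theorem isBigO_taylor_of_tendsto_fderiv_fderiv
    (hd : ∀ᶠ t in 𝓝 x₀ ×ˢ l, DifferentiableAt ℝ (g t.2) t.1)
    (hd' : ∀ᶠ t in 𝓝 x₀ ×ˢ l, DifferentiableAt ℝ (fderiv ℝ (g t.2)) t.1)
    (hA' : Tendsto (fun t : V × ι => fderiv ℝ (fderiv ℝ (g t.2)) t.1) (𝓝 x₀ ×ˢ l) (𝓝 A')) :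
    (fun t : (V × V) × ι => g t.2 t.1.2 - g t.2 t.1.1 - fderiv ℝ (g t.2) t.1.1 (t.1.2 - t.1.1))
      =O[𝓝 (x₀, x₀) ×ˢ l] fun t => ‖t.1.2 - t.1.1‖ ^ 2 := by
  have hO := isBigO_sub_of_tendsto_fderiv (g := fun i => fderiv ℝ (g i)) hd' hA'
  obtain ⟨C, hC, hlip⟩ := hO.exists_nonneg
  refine IsBigO.of_bound C ?_
  have hnear := ((tendsto_nhds_prod_snd x₀ x₀ l).eventually hd).and hlip.bound
  filter_upwards [eventually_forall_segment hnear] with t ht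
  rw [norm_pow, norm_norm, sq, ← mul_assoc]
  refine (convex_segment t.1.1 t.1.2).norm_image_sub_le_of_norm_fderiv_le'
    (fun z hz => (ht z hz).1) (fun z hz => (ht z hz).2.trans ?_)
    (left_mem_segment ℝ _ _) (right_mem_segment ℝ _ _)
  gcongr
  exact norm_sub_le_of_mem_segment hz

end FamiliesOfMaps

/-! ### Second order jets -/

section Jets

variable {V F : Type*} [NormedAddCommGroup V] [NormedSpace ℝ V]
  [NormedAddCommGroup F] [NormedSpace ℝ F]

variable (V F) in
/-- The space of `2`-jets at a point of maps from `V` to `F`. -/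
abbrev Jet2 : Type _ := F × (V →L[ℝ] F) × (V →L[ℝ] V →L[ℝ] F)

/-- The `2`-jet of `g` at `x`: its value and its first two derivatives, the data that the
`C²`-topology controls. -/
def jet2 (g : V → F) (x : V) : Jet2 V F :=
  (g x, fderiv ℝ g x, fderiv ℝ (fderiv ℝ g) x)

theorem continuousAt_jet2 {g : V → F} {x : V} (hg : ContDiffAt ℝ 2 g x) :
    ContinuousAt (jet2 g) x := by
  have hg' : ContDiffAt ℝ 1 (fderiv ℝ g) x := hg.fderiv_right (by norm_num)
  exact hg.continuousAt.prodMk (hg'.continuousAt.prodMk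
    (hg'.fderiv_right (m := 0) (by norm_num)).continuousAt)

theorem norm_le_sum_norm_apply {H κ : Type*} [NormedAddCommGroup H] [InnerProductSpace ℝ H]
    [Fintype κ] (b : OrthonormalBasis κ ℝ H) (A : H →L[ℝ] F) : ‖A‖ ≤ ∑ i, ‖A (b i)‖ := by
  refine A.opNorm_le_bound (Finset.sum_nonneg fun _ _ => norm_nonneg _) fun v => ?_
  calc ‖A v‖ = ‖∑ i, ⟪b i, v⟫_ℝ • A (b i)‖ := by
        simp only [← map_smul, ← map_sum, b.sum_repr']
    _ ≤ ∑ i, ‖A (b i)‖ * ‖v‖ := by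
        refine (norm_sum_le _ _).trans (Finset.sum_le_sum fun i _ => ?_)
        rw [norm_smul, mul_comm]
        gcongr
        simpa using norm_inner_le_norm (𝕜 := ℝ) (b i) v
    _ = (∑ i, ‖A (b i)‖) * ‖v‖ := (Finset.sum_mul ..).symm

end Jets

section NearDiagonal

variable {V E ι κ : Type*} [NormedAddCommGroup V] [NormedSpace ℝ V]
  [NormedAddCommGroup E] [InnerProductSpace ℝ E] [Fintype κ] [DecidableEq κ]
  {l : Filter ι} {g : ι → V → E} {x₀ : V} {J : Jet2 V E}

theorem isBigO_one_sub_combinedCos_of_tendsto_jet2 (b : Module.Basis κ ℝ V)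
    (hg : ∀ᶠ t in 𝓝 x₀ ×ˢ l, ContDiffAt ℝ 2 (g t.2) t.1)
    (hJ : Tendsto (fun t : V × ι => jet2 (g t.2) t.1) (𝓝 x₀ ×ˢ l) (𝓝 J))
    (hinj : Function.Injective J.2.1) :
    (fun t : (V × V) × ι => 1 - combinedCos (g t.2 t.1.2 - g t.2 t.1.1)
        (fun i => fderiv ℝ (g t.2) t.1.1 (b i)) (fun i => fderiv ℝ (g t.2) t.1.2 (b i)))
      =O[(𝓝 (x₀, x₀) ×ˢ l) ⊓ 𝓟 {t | t.1.1 ≠ t.1.2}]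
        fun t => ‖g t.2 t.1.2 - g t.2 t.1.1‖ ^ 2 := by
  have := b.finiteDimensional_of_finite
  set L := (𝓝 (x₀, x₀) ×ˢ l) ⊓ 𝓟 {t : (V × V) × ι | t.1.1 ≠ t.1.2}
  have hL : L ≤ 𝓝 (x₀, x₀) ×ˢ l := inf_le_left
  have hd : ∀ᶠ t in 𝓝 x₀ ×ˢ l, DifferentiableAt ℝ (g t.2) t.1 :=
    hg.mono fun t ht => ht.differentiableAt (by norm_num)
  have hd' : ∀ᶠ t in 𝓝 x₀ ×ˢ l, DifferentiableAt ℝ (fderiv ℝ (g t.2)) t.1 :=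
    hg.mono fun t ht => (ht.fderiv_right (m := 1) (by norm_num)).differentiableAt (by norm_num)
  have hD : Tendsto (fun t : V × ι => fderiv ℝ (g t.2) t.1) (𝓝 x₀ ×ˢ l) (𝓝 J.2.1) :=
    hJ.snd_nhds.fst_nhds
  have hD' : Tendsto (fun t : V × ι => fderiv ℝ (fderiv ℝ (g t.2)) t.1) (𝓝 x₀ ×ˢ l)
      (𝓝 J.2.2) := hJ.snd_nhds.snd_nhds
  have hxg := (isBigO_sub_of_tendsto_fderiv_injective hd hD hinj).mono hL
  have hx : Tendsto (fun t : (V × V) × ι => t.1.2 - t.1.1) L (𝓝 0) := by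
    have hsub : Continuous fun y : V × V => y.2 - y.1 := by fun_prop
    exact ((hsub.tendsto' (x₀, x₀) 0 (sub_self x₀)).comp tendsto_fst).mono_left hL
  have hz : Tendsto (fun t : (V × V) × ι => g t.2 t.1.2 - g t.2 t.1.1) L (𝓝 0) :=
    ((isBigO_sub_of_tendsto_fderiv hd hD).mono hL).trans_tendsto hx
  have hz0 : ∀ᶠ t in L, g t.2 t.1.2 - g t.2 t.1.1 ≠ 0 := by
    filter_upwards [hxg.eq_zero_imp, mem_inf_of_right (mem_principal_self _)] with t ht hne h0
    exact hne (sub_eq_zero.1 (ht h0)).symm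
  refine isBigO_one_sub_combinedCos (a₀ := fun i => J.2.1 (b i))
    (t := fun t => b.equivFun (t.1.2 - t.1.1)) (tendsto_pi_nhds.2 fun i => ?_)
    (b.linearIndependent.map' (J.2.1 : V →ₗ[ℝ] E) (LinearMap.ker_eq_bot.2 hinj)) hz hz0
    (fun i => ?_) ((b.equivFunL.toContinuousLinearMap.isBigO_comp _ _).trans hxg) ?_
  · exact ((ContinuousLinearMap.apply ℝ E (b i)).continuous.tendsto _).comp
      (hD.comp ((tendsto_nhds_prod_fst x₀ x₀ l).mono_left hL))
  · have hDx := (isBigO_sub_of_tendsto_fderiv (g := fun i => fderiv ℝ (g i)) hd' hD').mono hL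
    exact (((ContinuousLinearMap.apply ℝ E (b i)).isBigO_comp _ _).trans hDx).trans hxg
  · refine (((isBigO_taylor_of_tendsto_fderiv_fderiv hd hd' hD').mono hL).trans
      (hxg.norm_norm.pow 2)).congr_left fun t => ?_
    simp only [← map_smul, ← map_sum, b.sum_equivFun]

end NearDiagonal

/-! ### Embeddings in charts -/

section Charts

variable {E F M : Type*} [NormedAddCommGroup E] [NormedSpace ℝ E]
  [NormedAddCommGroup F] [NormedSpace ℝ F] [TopologicalSpace M] [ChartedSpace E M]
  {φ : OpenPartialHomeomorph M E} {f : M → F} {x : E}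

theorem contDiffAt_comp_chart_symm {r : WithTop ℕ∞} [IsManifold 𝓘(ℝ, E) r M]
    (hφ : φ ∈ atlas E M) (hf : ContMDiff 𝓘(ℝ, E) 𝓘(ℝ, F) r f) (hx : x ∈ φ.target) :
    ContDiffAt ℝ r (f ∘ φ.symm) x := by
  have hsymm : ContMDiffAt 𝓘(ℝ, E) 𝓘(ℝ, E) r φ.symm x :=
    (contMDiffOn_symm_of_mem_maximalAtlas (IsManifold.subset_maximalAtlas hφ)).contMDiffAt
      (φ.open_target.mem_nhds hx)
  exact contMDiffAt_iff_contDiffAt.1 (hf.contMDiffAt.comp x hsymm)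

theorem injective_fderiv_comp_chart_symm [IsManifold 𝓘(ℝ, E) 1 M] (hφ : φ ∈ atlas E M)
    (hf : MDifferentiable 𝓘(ℝ, E) 𝓘(ℝ, F) f)
    (hinj : ∀ p, Function.Injective (mfderiv 𝓘(ℝ, E) 𝓘(ℝ, F) f p)) (hx : x ∈ φ.target) :
    Function.Injective (fderiv ℝ (f ∘ φ.symm) x) := by
  rw [← mfderiv_eq_fderiv, mfderiv_comp x (hf _) (mdifferentiableAt_atlas_symm hφ hx)]
  exact (hinj _).comp ((mdifferentiable_of_mem_atlas hφ).symm.mfderiv_injective hx)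

end Charts

section Embeddings

variable {m n : ℕ} {k : ℕ∞} {M : ClosedOrientedManifold m k} (f : Emb M n)
  {φ : OpenPartialHomeomorph M (Euc m)} {p : M}

/-- The image under the derivative of `f` of the coordinate frame of the chart `φ` at `p`. -/
def chartFrame (f : M → Euc n) (φ : OpenPartialHomeomorph M (Euc m)) (p : M) : Fin m → Euc n :=
  fun i => fderiv ℝ (f ∘ φ.symm) (φ p) (EuclideanSpace.single i 1)

theorem Emb.injective_fderiv_comp_chart_symm (hk : 1 ≤ k) (hφ : φ ∈ atlas (Euc m) M)
    (hp : p ∈ φ.source) : Function.Injective (fderiv ℝ (f.toMap ∘ φ.symm) (φ p)) := by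
  have hk1 : (1 : WithTop ℕ∞) ≤ k := by exact_mod_cast hk
  have : IsManifold 𝓘(ℝ, Euc m) 1 M := IsManifold.of_le hk1
  exact KusnerSullivan.injective_fderiv_comp_chart_symm hφ
    (f.toMap.contMDiff.mdifferentiable (zero_lt_one.trans_le hk1).ne') f.immersion
    (φ.map_source hp)

theorem linearIndependent_chartFrame (hk : 1 ≤ k) (hφ : φ ∈ atlas (Euc m) M)
    (hp : p ∈ φ.source) : LinearIndependent ℝ (chartFrame f.toMap φ p) := by
  have h := (EuclideanSpace.basisFun (Fin m) ℝ).toBasis.linearIndependent.map'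
    (fderiv ℝ (f.toMap ∘ φ.symm) (φ p) : Euc m →ₗ[ℝ] Euc n)
    (LinearMap.ker_eq_bot.2 (f.injective_fderiv_comp_chart_symm hk hφ hp))
  unfold chartFrame
  simpa [Function.comp_def] using h

theorem mem_positiveFrames_iff (hk : 1 ≤ k) (hφ : φ ∈ atlas (Euc m) M) (hp : p ∈ φ.source)
    (e : Fin m → Euc n) :
    e ∈ positiveFrames f.toMap (f.toMap p) ↔ SameOrientation (chartFrame f.toMap φ p) e := by
  refine ⟨?_, fun he => ⟨φ, hφ, p, hp, rfl, he⟩⟩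
  rintro ⟨ψ, hψ, q, hq, hqp, he⟩
  obtain rfl := f.isEmbedding.injective hqp
  have hrefl : IsOrientationPreserving (Diffeomorph.refl 𝓘(ℝ, Euc m) M k) :=
    fun φ hφ ψ hψ p hp hq => M.oriented φ hφ ψ hψ p ⟨hp, hq⟩
  exact (sameOrientation_coordinateFrame hk hrefl (fun _ => rfl) hψ hφ hq hp).trans he

theorem cosCombinedAngle_eq_combinedCos_chartFrame (hm : 1 ≤ m) (hk : 1 ≤ k)
    {ψ : OpenPartialHomeomorph M (Euc m)} {q : M} (hφ : φ ∈ atlas (Euc m) M)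
    (hψ : ψ ∈ atlas (Euc m) M) (hp : p ∈ φ.source) (hq : q ∈ ψ.source) (hpq : p ≠ q) :
    cosCombinedAngle (positiveFrames f.toMap) (f.toMap p) (f.toMap q) =
      combinedCos (f.toMap q - f.toMap p) (chartFrame f.toMap φ p) (chartFrame f.toMap ψ q) :=
  cosCombinedAngle_eq_combinedCos hm
    (sub_ne_zero.2 fun h => hpq (f.isEmbedding.injective h).symm)
    (mem_positiveFrames_iff f hk hφ hp) (mem_positiveFrames_iff f hk hψ hq)
    (linearIndependent_chartFrame f hk hφ hp) (linearIndependent_chartFrame f hk hψ hq)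

end Embeddings

section JetCoordinates

variable {H F κ : Type*} [NormedAddCommGroup H] [InnerProductSpace ℝ H]
  [NormedAddCommGroup F] [NormedSpace ℝ F] [Fintype κ]

theorem dist_jet2_le (b : OrthonormalBasis κ ℝ H) {g h : H → F} {x : H} {ε : ℝ}
    (hgh : ∀ j ≤ 2, ∀ μ : Fin j → κ,
      ‖iteratedFDeriv ℝ j g x (fun i => b (μ i)) - iteratedFDeriv ℝ j h x (fun i => b (μ i))‖
        ≤ ε) :
    dist (jet2 g x) (jet2 h x) ≤ (1 + Fintype.card κ) ^ 2 * ε := by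
  have h₀ : dist (g x) (h x) ≤ ε := by
    simpa [dist_eq_norm] using hgh 0 (by norm_num) Fin.elim0
  have h₁ : dist (fderiv ℝ g x) (fderiv ℝ h x) ≤ Fintype.card κ * ε := by
    rw [dist_eq_norm]
    refine (norm_le_sum_norm_apply b _).trans ?_
    refine (Finset.sum_le_card_nsmul _ _ ε fun i _ => ?_).trans (by simp)
    simpa using hgh 1 (by norm_num) fun _ => i
  have h₂ : dist (fderiv ℝ (fderiv ℝ g) x) (fderiv ℝ (fderiv ℝ h) x)
      ≤ Fintype.card κ * (Fintype.card κ * ε) := by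
    refine (dist_eq_norm (E := H →L[ℝ] H →L[ℝ] F) _ _).trans_le ?_
    refine (norm_le_sum_norm_apply b _).trans ?_
    refine (Finset.sum_le_card_nsmul _ _ (Fintype.card κ * ε) fun i _ => ?_).trans (by simp)
    refine (norm_le_sum_norm_apply b _).trans ?_
    refine (Finset.sum_le_card_nsmul _ _ ε fun j _ => ?_).trans (by simp)
    simpa [iteratedFDeriv_two_apply] using hgh 2 le_rfl ![i, j]
  have hε : 0 ≤ ε := dist_nonneg.trans h₀
  have hκε : 0 ≤ Fintype.card κ * ε := by positivity
  have hκκε : 0 ≤ Fintype.card κ * (Fintype.card κ * ε) := by positivity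
  refine max_le (h₀.trans ?_) (max_le (h₁.trans ?_) (h₂.trans ?_)) <;> linarith

end JetCoordinates

/-! ### Local convergence in the `C²`-topology -/

theorem exists_isCountablyGenerated_tendstoUniformlyOn {α β ι κ : Type*} [UniformSpace β]
    [(uniformity β).IsCountablyGenerated] [Countable κ] {L : Filter ι} {K : κ → Set α}
    {F : κ → ι → α → β} {g : κ → α → β} (h : ∀ c, TendstoUniformlyOn (F c) (g c) L (K c)) :
    ∃ l : Filter ι, l.IsCountablyGenerated ∧ L ≤ l ∧
      ∀ c, TendstoUniformlyOn (F c) (g c) l (K c) := by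
  obtain ⟨u, hu⟩ := (uniformity β).exists_antitone_basis
  refine ⟨⨅ c, ⨅ j, 𝓟 {i | ∀ x ∈ K c, (g c x, F c i x) ∈ u j}, inferInstance,
    le_iInf₂ fun c j => le_principal_iff.2 (h c _ (hu.mem j)), fun c v hv => ?_⟩
  obtain ⟨j, hj⟩ := hu.mem_iff.1 hv
  filter_upwards [mem_iInf_of_mem c (mem_iInf_of_mem j (mem_principal_self _))]
    with i hi x hx using hj (hi x hx)

theorem tendsto_nhds_prod_of_tendstoUniformlyOn {X β ι : Type*} [TopologicalSpace X]
    [UniformSpace β] {l : Filter ι} {F : ι → X → β} {g : X → β} {s : Set X} {x : X}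
    (h : TendstoUniformlyOn F g l s) (hs : s ∈ 𝓝 x) (hg : ContinuousAt g x) :
    Tendsto (fun t : X × ι => F t.2 t.1) (𝓝 x ×ˢ l) (𝓝 (g x)) :=
  tendsto_comp_of_locally_uniform_limit (F := fun t : X × ι => F t.2) hg tendsto_fst
    fun u hu => ⟨s, hs, tendsto_snd.eventually (h u hu)⟩

section LocalConvergence

variable {m n : ℕ} {k : ℕ∞} {M : ClosedOrientedManifold m k} {l : Filter (Emb M n)}
  {f₀ : Emb M n} {φ : OpenPartialHomeomorph M (Euc m)} {K : Set M} {p₀ : M}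

/-- Convergence of the `2`-jets `(x, f) ↦ j²(f ∘ φ⁻¹)(x)` as the point tends to `p₀` and the
embedding tends to `f₀` along `l`: locally uniform `C²` convergence at `p₀`, in the chart `φ`. -/
def JetTendstoAt (l : Filter (Emb M n)) (f₀ : Emb M n) (φ : OpenPartialHomeomorph M (Euc m))
    (p₀ : M) : Prop :=
  Tendsto (fun t : Euc m × Emb M n => jet2 (t.2.toMap ∘ φ.symm) t.1) (𝓝 (φ p₀) ×ˢ l)
    (𝓝 (jet2 (f₀.toMap ∘ φ.symm) (φ p₀)))

/-- Locally uniform `C²` convergence of embeddings to `f₀` along `l`. -/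
def LocallyC2Tendsto (l : Filter (Emb M n)) (f₀ : Emb M n) : Prop :=
  ∀ p₀ : M, ∃ φ ∈ atlas (Euc m) M, p₀ ∈ φ.source ∧ JetTendstoAt l f₀ φ p₀

theorem Emb.continuousAt_jet2 (hk : 2 ≤ k) (f : Emb M n) (hφ : φ ∈ atlas (Euc m) M)
    (hp : p₀ ∈ φ.source) : ContinuousAt (jet2 (f.toMap ∘ φ.symm)) (φ p₀) :=
  KusnerSullivan.continuousAt_jet2
    ((contDiffAt_comp_chart_symm hφ f.toMap.contMDiff (φ.map_source hp)).of_le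
      (WithTop.coe_le_coe.2 hk : ((2 : ℕ∞) : WithTop ℕ∞) ≤ k))

theorem jetTendstoAt_pure (hk : 2 ≤ k) (f : Emb M n)
    (hφ : φ ∈ atlas (Euc m) M) (hp : p₀ ∈ φ.source) : JetTendstoAt (pure f) f φ p₀ := by
  rw [JetTendstoAt, prod_pure, tendsto_map'_iff]
  exact f.continuousAt_jet2 hk hφ hp

theorem locallyC2Tendsto_pure (hk : 2 ≤ k) (f : Emb M n) : LocallyC2Tendsto (pure f) f :=
  fun p => ⟨_, chart_mem_atlas (Euc m) p, mem_chart_source (Euc m) p,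
    jetTendstoAt_pure hk f (chart_mem_atlas (Euc m) p) (mem_chart_source (Euc m) p)⟩

theorem eventually_mem_subbasicSet (q : ℕ) (f₀ : Emb M n)
    (hφ : φ ∈ IsManifold.maximalAtlas 𝓘(ℝ, Euc m) k M) (hK : IsCompact K) (hKφ : K ⊆ φ.source)
    {ε : ℝ} (hε : 0 < ε) :
    ∀ᶠ f in @nhds _ (embTopology q M n) f₀,
      f.toMap ∈ subbasicSet q f₀.toMap φ (OpenPartialHomeomorph.refl (Euc n)) K ε := by
  let : TopologicalSpace C^k⟮𝓘(ℝ, Euc m), M; 𝓘(ℝ, Euc n), Euc n⟯ := compactOpenTopology q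
  let := embTopology q M n
  have hopen : IsOpen (subbasicSet q f₀.toMap φ (OpenPartialHomeomorph.refl (Euc n)) K ε) :=
    TopologicalSpace.isOpen_generateFrom_of_mem
      ⟨f₀.toMap, φ, OpenPartialHomeomorph.refl (Euc n), K, ε, hφ,
        IsManifold.subset_maximalAtlas (by simp), hK, hKφ, fun _ _ => mem_univ _, hε, rfl⟩
  exact continuous_induced_dom.continuousAt.eventually_mem (hopen.mem_nhds
    ⟨fun _ _ => mem_univ _, fun x _ j _ μ => by simpa using hε⟩)

theorem tendstoUniformlyOn_jet2 (f₀ : Emb M n)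
    (hφ : φ ∈ IsManifold.maximalAtlas 𝓘(ℝ, Euc m) k M) (hK : IsCompact K) (hKφ : K ⊆ φ.source) :
    TendstoUniformlyOn (fun (f : Emb M n) x => jet2 (f.toMap ∘ φ.symm) x)
      (jet2 (f₀.toMap ∘ φ.symm)) (@nhds _ (embTopology 2 M n) f₀) (φ '' K) := by
  refine (Metric.tendstoUniformlyOn_iff (α := Jet2 (Euc m) (Euc n))).2 fun ε hε => ?_
  have hδ : 0 < ε / (2 * (1 + m) ^ 2) := by positivity
  filter_upwards [eventually_mem_subbasicSet 2 f₀ hφ hK hKφ hδ] with f hf x hx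
  rw [dist_comm]
  refine (dist_jet2_le (EuclideanSpace.basisFun (Fin m) ℝ) (ε := ε / (2 * (1 + m) ^ 2))
    fun j hj μ => ?_).trans_lt ?_
  · simpa using (hf.2 x hx j hj μ).le
  · rw [Fintype.card_fin]
    field_simp
    linarith

-- Dominated convergence needs a countably generated filter, which the neighbourhoods of `f₀` in
-- the compact-open topology are not known to be.
theorem exists_locallyC2Tendsto (hk : 2 ≤ k) (f₀ : Emb M n) :
    ∃ l : Filter (Emb M n), l.IsCountablyGenerated ∧ @nhds _ (embTopology 2 M n) f₀ ≤ l ∧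
      LocallyC2Tendsto l f₀ := by
  choose K hK hKint hKsub using fun p : M => exists_compact_subset
    (chartAt (Euc m) p).open_source (mem_chart_source (Euc m) p)
  obtain ⟨s, -, hs⟩ := (isCompact_univ (X := M)).elim_nhds_subcover (fun p => interior (K p))
    fun p _ => isOpen_interior.mem_nhds (hKint p)
  have : (uniformity (Jet2 (Euc m) (Euc n))).IsCountablyGenerated :=
    EMetric.instIsCountablyGeneratedUniformity (α := Jet2 (Euc m) (Euc n))
  obtain ⟨l, hl, hfl, hunif⟩ := exists_isCountablyGenerated_tendstoUniformlyOn fun c : s =>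
    tendstoUniformlyOn_jet2 f₀ (IsManifold.chart_mem_maximalAtlas c.1) (hK c.1) (hKsub c.1)
  refine ⟨l, hl, hfl, fun p₀ => ?_⟩
  obtain ⟨c, hc, hpc⟩ := mem_iUnion₂.1 (hs (mem_univ p₀))
  have hp₀ := hKsub c (interior_subset hpc)
  have himage : chartAt (Euc m) c '' K c ∈ 𝓝 (chartAt (Euc m) c p₀) :=
    (chartAt (Euc m) c).image_mem_nhds hp₀ (mem_interior_iff_mem_nhds.1 hpc)
  exact ⟨_, chart_mem_atlas _ c, hp₀, tendsto_nhds_prod_of_tendstoUniformlyOn (hunif ⟨c, hc⟩)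
    himage (f₀.continuousAt_jet2 hk (chart_mem_atlas _ c) hp₀)⟩

end LocalConvergence

section JetConvergence

variable {m n : ℕ} {k : ℕ∞} {M : ClosedOrientedManifold m k} {l : Filter (Emb M n)}
  {f₀ : Emb M n} {φ : OpenPartialHomeomorph M (Euc m)} {p₀ : M}

theorem tendsto_chart_prod (l : Filter (Emb M n)) (hp : p₀ ∈ φ.source) :
    Tendsto (fun t : M × Emb M n => (φ t.1, t.2)) (𝓝 p₀ ×ˢ l) (𝓝 (φ p₀) ×ˢ l) :=
  (φ.continuousAt hp).tendsto.prodMap tendsto_id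

theorem tendsto_chart_prod_prod (l : Filter (Emb M n)) (hp : p₀ ∈ φ.source) :
    Tendsto (fun t : (M × M) × Emb M n => ((φ t.1.1, φ t.1.2), t.2)) (𝓝 (p₀, p₀) ×ˢ l)
      (𝓝 (φ p₀, φ p₀) ×ˢ l) := by
  have hφφ : Tendsto (Prod.map φ φ) (𝓝 (p₀, p₀)) (𝓝 (φ p₀, φ p₀)) :=
    (φ.continuousAt hp).prodMap (φ.continuousAt hp)
  exact hφφ.prodMap tendsto_id

theorem eventually_mem_chart_source (l : Filter (Emb M n)) (hp : p₀ ∈ φ.source)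
    {ψ : OpenPartialHomeomorph M (Euc m)} {q₀ : M} (hq : q₀ ∈ ψ.source) :
    ∀ᶠ t : (M × M) × Emb M n in 𝓝 (p₀, q₀) ×ˢ l, t.1.1 ∈ φ.source ∧ t.1.2 ∈ ψ.source :=
  tendsto_fst.eventually
    (prod_mem_nhds (φ.open_source.mem_nhds hp) (ψ.open_source.mem_nhds hq))

theorem JetTendstoAt.tendsto_apply (h : JetTendstoAt l f₀ φ p₀) (hp : p₀ ∈ φ.source) :
    Tendsto (fun t : M × Emb M n => t.2.toMap t.1) (𝓝 p₀ ×ˢ l) (𝓝 (f₀.toMap p₀)) := by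
  have hφ := (Tendsto.fst_nhds h).comp (tendsto_chart_prod l hp)
  rw [jet2, Function.comp_apply, φ.left_inv hp] at hφ
  refine hφ.congr' ?_
  filter_upwards [tendsto_fst.eventually (φ.open_source.eventually_mem hp)] with t ht
  exact congrArg t.2.toMap (φ.left_inv ht)

theorem JetTendstoAt.tendsto_fderiv (h : JetTendstoAt l f₀ φ p₀) :
    Tendsto (fun t : Euc m × Emb M n => fderiv ℝ (t.2.toMap ∘ φ.symm) t.1) (𝓝 (φ p₀) ×ˢ l)
      (𝓝 (fderiv ℝ (f₀.toMap ∘ φ.symm) (φ p₀))) :=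
  (Tendsto.snd_nhds h).fst_nhds

theorem JetTendstoAt.tendsto_chartFrame (h : JetTendstoAt l f₀ φ p₀) (hp : p₀ ∈ φ.source) :
    Tendsto (fun t : M × Emb M n => chartFrame t.2.toMap φ t.1) (𝓝 p₀ ×ˢ l)
      (𝓝 (chartFrame f₀.toMap φ p₀)) :=
  tendsto_pi_nhds.2 fun i => ((ContinuousLinearMap.apply ℝ (Euc n)
    (EuclideanSpace.single i (1 : ℝ) : Euc m)).continuous.tendsto _).comp
      (h.tendsto_fderiv.comp (tendsto_chart_prod l hp))

theorem eventually_forall_contDiffAt_comp_chart_symm (hφ : φ ∈ atlas (Euc m) M)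
    (hp : p₀ ∈ φ.source) :
    ∀ᶠ x in 𝓝 (φ p₀), ∀ f : Emb M n, ContDiffAt ℝ k (f.toMap ∘ φ.symm) x :=
  (φ.open_target.eventually_mem (φ.map_source hp)).mono fun _ hx f =>
    contDiffAt_comp_chart_symm hφ f.toMap.contMDiff hx

theorem JetTendstoAt.isLittleO_sub_sub (hk : 2 ≤ k) (h : JetTendstoAt l f₀ φ p₀)
    (hφ : φ ∈ atlas (Euc m) M) (hp : p₀ ∈ φ.source) :
    (fun t : (M × M) × Emb M n =>
      (t.2.toMap t.1.2 - t.2.toMap t.1.1) - (f₀.toMap t.1.2 - f₀.toMap t.1.1))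
      =o[𝓝 (p₀, p₀) ×ˢ l] fun t => f₀.toMap t.1.2 - f₀.toMap t.1.1 := by
  have hk1 : 1 ≤ k := one_le_two.trans hk
  have hk0 : (k : WithTop ℕ∞) ≠ 0 := by exact_mod_cast (zero_lt_one.trans_le hk1).ne'
  have hd : ∀ᶠ t : Euc m × Emb M n in 𝓝 (φ p₀) ×ˢ l,
      ∀ f : Emb M n, DifferentiableAt ℝ (f.toMap ∘ φ.symm) t.1 :=
    tendsto_fst.eventually ((eventually_forall_contDiffAt_comp_chart_symm hφ hp).mono
      fun _ hx f => (hx f).differentiableAt hk0)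
  have hA₀ : Tendsto (fun t : Euc m × Emb M n => fderiv ℝ (f₀.toMap ∘ φ.symm) t.1)
      (𝓝 (φ p₀) ×ˢ l) (𝓝 (fderiv ℝ (f₀.toMap ∘ φ.symm) (φ p₀))) :=
    ((f₀.continuousAt_jet2 hk hφ hp).tendsto.snd_nhds.fst_nhds).comp tendsto_fst
  have hdiff := (isLittleO_sub_sub_of_tendsto_fderiv
    (g := fun f : Emb M n => f.toMap ∘ φ.symm) (hd.mono fun t ht => ht t.2) h.tendsto_fderiv).sub
      (isLittleO_sub_sub_of_tendsto_fderiv (g := fun _ => f₀.toMap ∘ φ.symm)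
        (hd.mono fun _ ht => ht f₀) hA₀)
  have hinv := isBigO_sub_of_tendsto_fderiv_injective (g := fun _ => f₀.toMap ∘ φ.symm)
    (hd.mono fun _ ht => ht f₀) hA₀ (f₀.injective_fderiv_comp_chart_symm hk1 hφ hp)
  refine ((hdiff.trans_isBigO hinv).comp_tendsto (tendsto_chart_prod_prod l hp)).congr' ?_ ?_ <;>
  · filter_upwards [eventually_mem_chart_source l hp hp] with t ht
    simp [φ.left_inv ht.1, φ.left_inv ht.2]

theorem JetTendstoAt.isBigO_one_sub_cosCombinedAngle (hm : 1 ≤ m) (hk : 2 ≤ k)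
    (h : JetTendstoAt l f₀ φ p₀) (hφ : φ ∈ atlas (Euc m) M) (hp : p₀ ∈ φ.source) :
    (fun t : (M × M) × Emb M n =>
      1 - cosCombinedAngle (positiveFrames t.2.toMap) (t.2.toMap t.1.1) (t.2.toMap t.1.2))
      =O[(𝓝 (p₀, p₀) ×ˢ l) ⊓ 𝓟 {t | t.1.1 ≠ t.1.2}]
      fun t => ‖t.2.toMap t.1.2 - t.2.toMap t.1.1‖ ^ 2 := by
  have hk1 : 1 ≤ k := one_le_two.trans hk
  have hk2 : ((2 : ℕ∞) : WithTop ℕ∞) ≤ k := WithTop.coe_le_coe.2 hk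
  have hsource := eventually_mem_chart_source l hp hp
  have hC2 : ∀ᶠ t : Euc m × Emb M n in 𝓝 (φ p₀) ×ˢ l,
      ContDiffAt ℝ 2 (t.2.toMap ∘ φ.symm) t.1 :=
    tendsto_fst.eventually (eventually_forall_contDiffAt_comp_chart_symm hφ hp) |>.mono
      fun t ht => (ht t.2).of_le hk2
  have hO := isBigO_one_sub_combinedCos_of_tendsto_jet2
    (g := fun (f : Emb M n) => f.toMap ∘ φ.symm) (EuclideanSpace.basisFun (Fin m) ℝ).toBasis
    hC2 h (f₀.injective_fderiv_comp_chart_symm hk1 hφ hp)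
  have hne : Tendsto (fun t : (M × M) × Emb M n => ((φ t.1.1, φ t.1.2), t.2))
      ((𝓝 (p₀, p₀) ×ˢ l) ⊓ 𝓟 {t | t.1.1 ≠ t.1.2})
      ((𝓝 (φ p₀, φ p₀) ×ˢ l) ⊓ 𝓟 {t | t.1.1 ≠ t.1.2}) := by
    refine tendsto_inf.2 ⟨(tendsto_chart_prod_prod l hp).mono_left inf_le_left,
      tendsto_principal.2 (eventually_inf_principal.2 ?_)⟩
    filter_upwards [hsource] with t ht hpq using φ.injOn.ne ht.1 ht.2 hpq
  refine (hO.comp_tendsto hne).congr' ?_ ?_ <;> refine eventually_inf_principal.2 ?_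
  · filter_upwards [hsource] with t ht hpq
    rw [cosCombinedAngle_eq_combinedCos_chartFrame t.2 hm hk1 hφ hφ ht.1 ht.2 hpq]
    simp only [Function.comp_apply, φ.left_inv ht.1, φ.left_inv ht.2,
      OrthonormalBasis.coe_toBasis, EuclideanSpace.basisFun_apply]
    rfl
  · filter_upwards [hsource] with t ht _
    simp [φ.left_inv ht.1, φ.left_inv ht.2]

end JetConvergence

/-! ### Uniform estimates on the parameter space -/

theorem eventually_forall_of_forall_eventually_prod {X ι : Type*} [TopologicalSpace X]
    [CompactSpace X] {l : Filter ι} {P : X × ι → Prop} (h : ∀ x, ∀ᶠ t in 𝓝 x ×ˢ l, P t) :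
    ∀ᶠ i in l, ∀ x, P (x, i) := by
  have hmem : {t | P t} ∈ 𝓝ˢ (univ : Set X) ×ˢ l :=
    isCompact_univ.mem_nhdsSet_prod_of_forall fun x _ => h x
  rw [nhdsSet_univ, prod_comm, mem_map] at hmem
  exact mem_prod_top.1 hmem

theorem exists_eventually_forall_le {X ι : Type*} [TopologicalSpace X] [CompactSpace X]
    {l : Filter ι} {F : X × ι → ℝ} (h : ∀ x, ∃ B, ∀ᶠ t in 𝓝 x ×ˢ l, F t ≤ B) :
    ∃ B, ∀ᶠ i in l, ∀ x, F (x, i) ≤ B := by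
  -- The bound is an additional parameter tending to `∞`.
  have hlarge : ∀ᶠ c : ι × ℝ in l ×ˢ atTop, ∀ x, F (x, c.1) ≤ c.2 := by
    refine eventually_forall_of_forall_eventually_prod
      (P := fun t : X × (ι × ℝ) => F (t.1, t.2.1) ≤ t.2.2) fun x => ?_
    obtain ⟨B, hB⟩ := h x
    obtain ⟨px, hx, pi, hi, hxi⟩ := eventually_prod_iff.1 hB
    filter_upwards [hx.prod_mk (hi.prod_mk (eventually_ge_atTop B))]
      with t ht using (hxi ht.1 ht.2.1).trans ht.2.2
  exact (eventually_swap_iff.1 hlarge).curry.exists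

section UniformEstimates

variable {m n : ℕ} {k : ℕ∞} {M : ClosedOrientedManifold m k} {l : Filter (Emb M n)}
  {f₀ : Emb M n}

theorem LocallyC2Tendsto.tendsto_apply (h : LocallyC2Tendsto l f₀) (p₀ : M) :
    Tendsto (fun t : M × Emb M n => t.2.toMap t.1) (𝓝 p₀ ×ˢ l) (𝓝 (f₀.toMap p₀)) := by
  obtain ⟨φ, -, hp, hJ⟩ := h p₀
  exact hJ.tendsto_apply hp

theorem LocallyC2Tendsto.tendsto_apply_sub_apply (h : LocallyC2Tendsto l f₀) (p₀ q₀ : M) :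
    Tendsto (fun t : (M × M) × Emb M n => t.2.toMap t.1.2 - t.2.toMap t.1.1) (𝓝 (p₀, q₀) ×ˢ l)
      (𝓝 (f₀.toMap q₀ - f₀.toMap p₀)) :=
  ((h.tendsto_apply q₀).comp (tendsto_nhds_prod_snd p₀ q₀ l)).sub
    ((h.tendsto_apply p₀).comp (tendsto_nhds_prod_fst p₀ q₀ l))

theorem LocallyC2Tendsto.isLittleO_sub_sub (hk : 2 ≤ k) (h : LocallyC2Tendsto l f₀)
    (p₀ q₀ : M) :
    (fun t : (M × M) × Emb M n =>
      (t.2.toMap t.1.2 - t.2.toMap t.1.1) - (f₀.toMap t.1.2 - f₀.toMap t.1.1))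
      =o[𝓝 (p₀, q₀) ×ˢ l] fun t => f₀.toMap t.1.2 - f₀.toMap t.1.1 := by
  rcases eq_or_ne p₀ q₀ with rfl | hpq
  · obtain ⟨φ, hφ, hp, hJ⟩ := h p₀
    exact hJ.isLittleO_sub_sub hk hφ hp
  · have hne : f₀.toMap q₀ - f₀.toMap p₀ ≠ 0 :=
      sub_ne_zero.2 fun heq => hpq (f₀.isEmbedding.injective heq).symm
    have hcont : Continuous fun t : M × M => f₀.toMap t.2 - f₀.toMap t.1 :=
      (f₀.toMap.contMDiff.continuous.comp continuous_snd).sub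
        (f₀.toMap.contMDiff.continuous.comp continuous_fst)
    have h₀ : Tendsto (fun t : (M × M) × Emb M n => f₀.toMap t.1.2 - f₀.toMap t.1.1)
        (𝓝 (p₀, q₀) ×ˢ l) (𝓝 (f₀.toMap q₀ - f₀.toMap p₀)) :=
      (hcont.tendsto (p₀, q₀)).comp tendsto_fst
    have hdiff := (h.tendsto_apply_sub_apply p₀ q₀).sub h₀
    rw [sub_self] at hdiff
    exact ((isLittleO_const_iff hne).2 hdiff).trans_isBigO
      ((isEquivalent_const_iff_tendsto hne).2 h₀).symm.isBigO

theorem LocallyC2Tendsto.eventually_norm_sub_sub_le (hk : 2 ≤ k) (h : LocallyC2Tendsto l f₀)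
    {ε : ℝ} (hε : 0 < ε) : ∀ᶠ f in l, ∀ t : M × M,
      ‖(f.toMap t.2 - f.toMap t.1) - (f₀.toMap t.2 - f₀.toMap t.1)‖
        ≤ ε * ‖f₀.toMap t.2 - f₀.toMap t.1‖ :=
  eventually_forall_of_forall_eventually_prod (l := l) (P := fun t : (M × M) × Emb M n =>
    ‖(t.2.toMap t.1.2 - t.2.toMap t.1.1) - (f₀.toMap t.1.2 - f₀.toMap t.1.1)‖
      ≤ ε * ‖f₀.toMap t.1.2 - f₀.toMap t.1.1‖) fun t => (h.isLittleO_sub_sub hk t.1 t.2).bound hε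

/-- The integrand of the energy of `f`, on the parameter space `M × M`. On the diagonal it is a
division by zero, hence `0`. -/
def Emb.integrand (f : Emb M n) (t : M × M) : ℝ :=
  (1 - cosCombinedAngle (positiveFrames f.toMap) (f.toMap t.1) (f.toMap t.2)) ^ m /
    dist (f.toMap t.1) (f.toMap t.2) ^ (2 * m)

theorem Emb.integrand_self (hm : 1 ≤ m) (f : Emb M n) (p : M) : f.integrand (p, p) = 0 := by
  have hm2 : 2 * m ≠ 0 := by omega
  simp [Emb.integrand, hm2]

theorem LocallyC2Tendsto.tendsto_cosCombinedAngle (hm : 1 ≤ m) (hk : 1 ≤ k)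
    (h : LocallyC2Tendsto l f₀) {p₀ q₀ : M} (hpq : p₀ ≠ q₀) :
    Tendsto (fun t : (M × M) × Emb M n =>
        cosCombinedAngle (positiveFrames t.2.toMap) (t.2.toMap t.1.1) (t.2.toMap t.1.2))
      (𝓝 (p₀, q₀) ×ˢ l)
      (𝓝 (cosCombinedAngle (positiveFrames f₀.toMap) (f₀.toMap p₀) (f₀.toMap q₀))) := by
  obtain ⟨φ, hφ, hp, hJφ⟩ := h p₀
  obtain ⟨ψ, hψ, hq, hJψ⟩ := h q₀
  have hcos := tendsto_combinedCos (h.tendsto_apply_sub_apply p₀ q₀)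
    (sub_ne_zero.2 fun heq => hpq (f₀.isEmbedding.injective heq).symm)
    ((hJφ.tendsto_chartFrame hp).comp (tendsto_nhds_prod_fst p₀ q₀ l))
    ((hJψ.tendsto_chartFrame hq).comp (tendsto_nhds_prod_snd p₀ q₀ l))
    (linearIndependent_chartFrame f₀ hk hφ hp) (linearIndependent_chartFrame f₀ hk hψ hq)
  rw [← cosCombinedAngle_eq_combinedCos_chartFrame f₀ hm hk hφ hψ hp hq hpq] at hcos
  refine hcos.congr' ?_
  filter_upwards [eventually_mem_chart_source l hp hq, tendsto_fst.eventually
    ((isOpen_ne_fun continuous_fst continuous_snd).eventually_mem hpq)] with t ht hne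
  exact (cosCombinedAngle_eq_combinedCos_chartFrame t.2 hm hk hφ hψ ht.1 ht.2 hne).symm

theorem LocallyC2Tendsto.tendsto_integrand (hm : 1 ≤ m) (hk : 1 ≤ k)
    (h : LocallyC2Tendsto l f₀) {p₀ q₀ : M} (hpq : p₀ ≠ q₀) :
    Tendsto (fun t : (M × M) × Emb M n => t.2.integrand t.1) (𝓝 (p₀, q₀) ×ˢ l)
      (𝓝 (f₀.integrand (p₀, q₀))) := by
  have hdist := ((h.tendsto_apply p₀).comp (tendsto_nhds_prod_fst p₀ q₀ l)).dist
    ((h.tendsto_apply q₀).comp (tendsto_nhds_prod_snd p₀ q₀ l))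
  exact (((h.tendsto_cosCombinedAngle hm hk hpq).const_sub 1).pow m).div (hdist.pow (2 * m))
    (pow_ne_zero _ (dist_ne_zero.2 (f₀.isEmbedding.injective.ne hpq)))

theorem LocallyC2Tendsto.exists_eventually_integrand_le_nhds_diag (hm : 1 ≤ m) (hk : 2 ≤ k)
    (h : LocallyC2Tendsto l f₀) (p₀ : M) :
    ∃ B : ℝ, ∀ᶠ t in 𝓝 (p₀, p₀) ×ˢ l, t.2.integrand t.1 ≤ B := by
  obtain ⟨φ, hφ, hp, hJ⟩ := h p₀
  obtain ⟨B, hB₀, hB⟩ := (hJ.isBigO_one_sub_cosCombinedAngle hm hk hφ hp).exists_pos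
  refine ⟨B ^ m, (eventually_inf_principal.1 hB.bound).mono ?_⟩
  rintro ⟨⟨p, q⟩, f⟩ hpqf
  rcases eq_or_ne p q with rfl | hpq
  · rw [f.integrand_self hm]
    positivity
  · have hd : 0 < dist (f.toMap p) (f.toMap q) := dist_pos.2 (f.isEmbedding.injective.ne hpq)
    have hle := hpqf hpq
    rw [norm_pow, norm_norm, ← dist_eq_norm (f.toMap q), dist_comm] at hle
    rw [Emb.integrand, div_le_iff₀ (by positivity), pow_mul, ← mul_pow]
    refine (Real.le_norm_self _).trans ?_
    rw [norm_pow]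
    exact pow_le_pow_left₀ (norm_nonneg _) hle m

theorem LocallyC2Tendsto.exists_eventually_integrand_le (hm : 1 ≤ m) (hk : 2 ≤ k)
    (h : LocallyC2Tendsto l f₀) : ∃ B : ℝ, ∀ᶠ f in l, ∀ t : M × M, f.integrand t ≤ B := by
  refine exists_eventually_forall_le
    (F := fun t : (M × M) × Emb M n => t.2.integrand t.1) fun ⟨p₀, q₀⟩ => ?_
  rcases eq_or_ne p₀ q₀ with rfl | hpq
  · exact h.exists_eventually_integrand_le_nhds_diag hm hk p₀
  · have hlim := h.tendsto_integrand hm (one_le_two.trans hk) hpq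
    exact ⟨f₀.integrand (p₀, q₀) + 1, hlim.eventually_le_const (lt_add_one _)⟩

end UniformEstimates

/-! ### Volume and energy -/

theorem euclideanHausdorffMeasure_image_le_of_edist_le {X Y Z : Type*} [EMetricSpace X]
    [MeasurableSpace X] [BorelSpace X] [EMetricSpace Y] [MeasurableSpace Y] [BorelSpace Y]
    {f : Z → Y} {g : Z → X} {s : Set Z} {K : ℝ≥0}
    (h : ∀ x ∈ s, ∀ y ∈ s, edist (f x) (f y) ≤ K * edist (g x) (g y)) (d : ℕ) :
    μHE[d] (f '' s) ≤ (K : ℝ≥0∞) ^ d * μHE[d] (g '' s) := by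
  rcases s.eq_empty_or_nonempty with rfl | ⟨x₀, -⟩
  · simp
  have : Nonempty Z := ⟨x₀⟩
  set g' := Function.invFunOn g s
  have hmem : ∀ x ∈ s, g' (g x) ∈ s := fun x hx => Function.invFunOn_mem ⟨x, hx, rfl⟩
  have hinv : ∀ x ∈ s, g (g' (g x)) = g x := fun x hx => Function.invFunOn_eq ⟨x, hx, rfl⟩
  have hlip : LipschitzOnWith K (f ∘ g') (g '' s) := by
    rintro _ ⟨x, hx, rfl⟩ _ ⟨y, hy, rfl⟩
    simpa only [Function.comp, hinv x hx, hinv y hy] using h _ (hmem x hx) _ (hmem y hy)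
  have himage : (f ∘ g') '' (g '' s) = f '' s := by
    rw [image_image]
    refine image_congr fun x hx => ?_
    have hle := h _ (hmem x hx) _ hx
    rwa [hinv x hx, edist_self, mul_zero, nonpos_iff_eq_zero, edist_eq_zero] at hle
  have hle := hlip.hausdorffMeasure_image_le (d := d) (Nat.cast_nonneg d)
  rw [himage, ENNReal.rpow_natCast] at hle
  rw [Measure.euclideanHausdorffMeasure_def, Measure.euclideanHausdorffMeasure_def,
    Measure.smul_apply, Measure.smul_apply, mul_smul_comm]
  exact smul_le_smul_of_nonneg_left hle zero_le

theorem tendsto_of_eventually_le_mul {ι : Type*} {l : Filter ι} {u v : ι → ℝ≥0∞} {a : ℝ≥0∞}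
    (hu : Tendsto u l (𝓝 a))
    (h : ∀ K : ℝ≥0, 1 < K → ∀ᶠ i in l, u i ≤ K * v i ∧ v i ≤ K * u i) :
    Tendsto v l (𝓝 a) := by
  have hle : ∀ c : ℝ≥0∞, 1 < c → ∀ᶠ i in l, u i ≤ c * v i ∧ v i ≤ c * u i := by
    intro c hc
    obtain ⟨K, hK, hKc⟩ := ENNReal.lt_iff_exists_nnreal_btwn.1 hc
    filter_upwards [h K (by exact_mod_cast hK)] with i hi
    exact ⟨hi.1.trans (by gcongr), hi.2.trans (by gcongr)⟩
  refine tendsto_of_le_liminf_of_limsup_le ?_ ?_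
  · rw [← mul_one (liminf v l)]
    refine ENNReal.le_mul_of_forall_lt (.inr ENNReal.one_ne_top) (.inr one_ne_zero)
      fun b hb c hc => ?_
    refine le_of_tendsto_of_frequently hu
      (((frequently_lt_of_liminf_lt (by isBoundedDefault) hb).and_eventually (hle c hc)).mono
        fun i hi => ?_)
    rw [mul_comm]
    exact hi.2.1.trans (by gcongr; exact hi.1.le)
  · rw [← mul_one a]
    refine ENNReal.le_mul_of_forall_lt (.inr ENNReal.one_ne_top) (.inr one_ne_zero)
      fun b hb c hc => limsup_le_of_le (by isBoundedDefault) ?_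
    filter_upwards [hu.eventually_lt_const hb, hle c hc] with i hib hi
    rw [mul_comm]
    exact hi.2.trans (by gcongr)

section Energy

variable {m n : ℕ} {k : ℕ∞} {M : ClosedOrientedManifold m k}

instance : MeasurableSpace M := borel M

instance : BorelSpace M := ⟨rfl⟩

instance : SecondCountableTopology M :=
  ChartedSpace.secondCountable_of_sigmaCompact (Euc m) M

theorem Emb.measurableEmbedding (f : Emb M n) : MeasurableEmbedding f.toMap :=
  (f.toMap.contMDiff.continuous.isClosedEmbedding f.isEmbedding.injective).measurableEmbedding

/-- The volume of an embedded submanifold, as a measure on its parameter space. -/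
def Emb.volume (f : Emb M n) : Measure M := Measure.comap f.toMap μHE[m]

theorem Emb.volume_apply (f : Emb M n) (s : Set M) : f.volume s = μHE[m] (f.toMap '' s) :=
  f.measurableEmbedding.comap_apply _ _

theorem Emb.finiteAt_volume (hk : 1 ≤ k) (f : Emb M n) (p : M) :
    f.volume.FiniteAtFilter (𝓝 p) := by
  obtain ⟨φ, hφ, hp⟩ : ∃ φ ∈ atlas (Euc m) M, p ∈ φ.source :=
    ⟨_, chart_mem_atlas (Euc m) p, mem_chart_source (Euc m) p⟩
  have hC1 : ContDiffAt ℝ 1 (f.toMap ∘ φ.symm) (φ p) :=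
    (contDiffAt_comp_chart_symm hφ f.toMap.contMDiff (φ.map_source hp)).of_le
      (WithTop.coe_le_coe.2 hk : ((1 : ℕ∞) : WithTop ℕ∞) ≤ k)
  obtain ⟨K, t, ht, hK⟩ := hC1.exists_lipschitzOnWith
  refine ⟨φ.source ∩ φ ⁻¹' (t ∩ Metric.ball (φ p) 1), inter_mem (φ.open_source.mem_nhds hp)
    ((φ.continuousAt hp).preimage_mem_nhds
      (inter_mem ht (Metric.ball_mem_nhds _ one_pos))), ?_⟩
  rw [f.volume_apply]
  refine (euclideanHausdorffMeasure_image_le_of_edist_le (g := φ) (K := K)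
    (fun x hx y hy => ?_) m).trans_lt ?_
  · simpa only [Function.comp, φ.left_inv hx.1, φ.left_inv hy.1] using hK hx.2.1 hy.2.1
  · rw [EuclideanSpace.euclideanHausdorffMeasure_eq_volume]
    refine ENNReal.mul_lt_top (ENNReal.pow_lt_top ENNReal.coe_lt_top)
      ((measure_mono ?_).trans_lt (measure_ball_lt_top (x := φ p) (r := 1)))
    rintro _ ⟨x, hx, rfl⟩
    exact hx.2.2

theorem Emb.isFiniteMeasure_volume (hk : 1 ≤ k) (f : Emb M n) : IsFiniteMeasure f.volume :=
  have : IsLocallyFiniteMeasure f.volume := ⟨f.finiteAt_volume hk⟩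
  inferInstance

theorem Emb.volume_le {f g : Emb M n} {K : ℝ≥0}
    (h : ∀ t : M × M, ‖f.toMap t.2 - f.toMap t.1‖ ≤ K * ‖g.toMap t.2 - g.toMap t.1‖) :
    f.volume ≤ (K : ℝ≥0∞) ^ m • g.volume := by
  refine Measure.le_iff.2 fun s _ => ?_
  rw [Measure.smul_apply, f.volume_apply, g.volume_apply]
  refine euclideanHausdorffMeasure_image_le_of_edist_le (fun x _ y _ => ?_) m
  rw [edist_nndist, edist_nndist, ← ENNReal.coe_mul, ENNReal.coe_le_coe, ← NNReal.coe_le_coe,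
    NNReal.coe_mul, coe_nndist, coe_nndist, dist_eq_norm, dist_eq_norm]
  exact h (y, x)

/-- The energy of `f` with the volume of `f` replaced by an arbitrary measure `μ` on the parameter
space. Freezing `μ` while `f` varies separates the convergence of the integrand from that of the
volume. -/
def energyWith (f : Emb M n) (μ : Measure M) : ℝ≥0∞ :=
  ∫⁻ p, ∫⁻ q, ENNReal.ofReal (f.integrand (p, q)) ∂μ ∂μ

theorem energyOfMap_eq_energyWith (f : Emb M n) :
    energyOfMap f.toMap = energyWith f f.volume := by
  have hmap : (μHE[m] : Measure (Euc n)).restrict (range f.toMap) = f.volume.map f.toMap :=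
    (f.measurableEmbedding.map_comap _).symm
  simp only [energyOfMap, hmap, f.measurableEmbedding.lintegral_map]
  rfl

theorem energyWith_le_of_le_smul (f : Emb M n) {μ ν : Measure M} {c : ℝ≥0∞} (h : μ ≤ c • ν)
    (hc : c ≠ ⊤) : energyWith f μ ≤ c * c * energyWith f ν :=
  calc energyWith f μ
      ≤ ∫⁻ p, ∫⁻ q, ENNReal.ofReal (f.integrand (p, q)) ∂c • ν ∂c • ν :=
        lintegral_mono' h fun _ => lintegral_mono' h le_rfl
    _ = c * c * energyWith f ν := by
        simp only [lintegral_smul_measure, smul_eq_mul, lintegral_const_mul' _ _ hc, mul_assoc,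
          energyWith]

theorem Emb.continuousOn_integrand (hm : 1 ≤ m) (hk : 2 ≤ k) (f : Emb M n) :
    ContinuousOn f.integrand {t | t.1 ≠ t.2} := by
  rintro ⟨p, q⟩ hpq
  have hlim := (locallyC2Tendsto_pure hk f).tendsto_integrand hm (one_le_two.trans hk) hpq
  rw [prod_pure, tendsto_map'_iff] at hlim
  exact ContinuousAt.continuousWithinAt hlim

theorem Emb.measurable_integrand (hm : 1 ≤ m) (hk : 2 ≤ k) (f : Emb M n) :
    Measurable f.integrand := by
  classical
  have hpiecewise : f.integrand = {t : M × M | t.1 ≠ t.2}.piecewise f.integrand fun _ => 0 := by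
    ext1 ⟨p, q⟩
    rcases eq_or_ne p q with rfl | hpq
    · rw [piecewise_eq_of_notMem _ _ _ (by simp), f.integrand_self hm]
    · rw [piecewise_eq_of_mem _ _ _ hpq]
  rw [hpiecewise]
  exact (f.continuousOn_integrand hm hk).measurable_piecewise continuousOn_const
    (isOpen_ne_fun continuous_fst continuous_snd).measurableSet

theorem energyWith_eq_lintegral_prod (hm : 1 ≤ m) (hk : 2 ≤ k) (f : Emb M n) (μ : Measure M)
    [SFinite μ] : energyWith f μ = ∫⁻ t, ENNReal.ofReal (f.integrand t) ∂μ.prod μ := by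
  rw [lintegral_prod _ (f.measurable_integrand hm hk).ennreal_ofReal.aemeasurable, energyWith]

theorem energyWith_lt_top (hm : 1 ≤ m) (hk : 2 ≤ k) (f : Emb M n) (μ : Measure M)
    [IsFiniteMeasure μ] : energyWith f μ < ⊤ := by
  obtain ⟨B, hB⟩ := (locallyC2Tendsto_pure hk f).exists_eventually_integrand_le hm hk
  rw [energyWith_eq_lintegral_prod hm hk]
  calc ∫⁻ t, ENNReal.ofReal (f.integrand t) ∂μ.prod μ
      ≤ ∫⁻ _, ENNReal.ofReal B ∂μ.prod μ :=
        lintegral_mono fun t => ENNReal.ofReal_le_ofReal (eventually_pure.1 hB t)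
    _ < ⊤ := lintegral_const_lt_top ENNReal.ofReal_ne_top

theorem energyOfMap_lt_top (hm : 1 ≤ m) (hk : 2 ≤ k) (f : Emb M n) :
    energyOfMap f.toMap < ⊤ := by
  have := f.isFiniteMeasure_volume (one_le_two.trans hk)
  rw [energyOfMap_eq_energyWith]
  exact energyWith_lt_top hm hk f f.volume

variable {l : Filter (Emb M n)} {f₀ : Emb M n}

theorem LocallyC2Tendsto.tendsto_integrand_apply (hm : 1 ≤ m) (hk : 1 ≤ k)
    (h : LocallyC2Tendsto l f₀) (t : M × M) :
    Tendsto (fun f : Emb M n => f.integrand t) l (𝓝 (f₀.integrand t)) := by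
  obtain ⟨p, q⟩ := t
  rcases eq_or_ne p q with rfl | hpq
  · simp only [Emb.integrand_self hm, tendsto_const_nhds]
  · have hpair : Tendsto (fun f : Emb M n => ((p, q), f)) l (𝓝 (p, q) ×ˢ l) :=
      tendsto_const_nhds.prodMk tendsto_id
    simpa only [Function.comp_def] using (h.tendsto_integrand hm hk hpq).comp hpair

theorem LocallyC2Tendsto.tendsto_energyWith (hm : 1 ≤ m) (hk : 2 ≤ k)
    [l.IsCountablyGenerated] (h : LocallyC2Tendsto l f₀) (μ : Measure M) [IsFiniteMeasure μ] :
    Tendsto (fun f => energyWith f μ) l (𝓝 (energyWith f₀ μ)) := by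
  simp_rw [energyWith_eq_lintegral_prod hm hk]
  obtain ⟨B, hB⟩ := h.exists_eventually_integrand_le hm hk
  exact tendsto_lintegral_filter_of_dominated_convergence (fun _ => ENNReal.ofReal B)
    (.of_forall fun f => (f.measurable_integrand hm hk).ennreal_ofReal)
    (hB.mono fun f hf => .of_forall fun t => ENNReal.ofReal_le_ofReal (hf t))
    (lintegral_const_lt_top ENNReal.ofReal_ne_top).ne
    (.of_forall fun t => ENNReal.tendsto_ofReal
      (h.tendsto_integrand_apply hm (one_le_two.trans hk) t))

theorem LocallyC2Tendsto.eventually_volume_le (hk : 2 ≤ k) (h : LocallyC2Tendsto l f₀)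
    {K : ℝ≥0} (hK : 1 < K) : ∀ᶠ f in l, f.volume ≤ (K : ℝ≥0∞) ^ m • f₀.volume ∧
      f₀.volume ≤ (K : ℝ≥0∞) ^ m • f.volume := by
  have hK1 : (1 : ℝ) < K := by exact_mod_cast hK
  have hK0 : (0 : ℝ) < K := one_pos.trans hK1
  have hε : (0 : ℝ) < (K - 1) / K := div_pos (sub_pos.2 hK1) hK0
  filter_upwards [h.eventually_norm_sub_sub_le hk hε] with f hf
  refine ⟨Emb.volume_le fun t => ?_, Emb.volume_le fun t => ?_⟩ <;>
  · have hle := hf t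
    rw [div_mul_eq_mul_div, le_div_iff₀ hK0] at hle
    set u := f.toMap t.2 - f.toMap t.1
    set u₀ := f₀.toMap t.2 - f₀.toMap t.1
    have hu := norm_sub_norm_le u u₀
    have hu₀ := norm_sub_norm_le u₀ u
    rw [norm_sub_rev u₀] at hu₀
    nlinarith [norm_nonneg (u - u₀)]

theorem LocallyC2Tendsto.eventually_energyWith_volume_le (hk : 2 ≤ k)
    (h : LocallyC2Tendsto l f₀) {K : ℝ≥0} (hK : 1 < K) :
    ∀ᶠ f in l, energyWith f f₀.volume ≤ K * energyWith f f.volume ∧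
      energyWith f f.volume ≤ K * energyWith f f₀.volume := by
  have hcont : Continuous fun r : ℝ≥0 => r ^ m * r ^ m := by fun_prop
  obtain ⟨r, hrK, hr⟩ := ((((hcont.tendsto' 1 1 (by simp)).mono_left
    (nhdsWithin_le_nhds (s := Ioi 1))).eventually_lt_const hK).and self_mem_nhdsWithin).exists
  have hrK' : (r : ℝ≥0∞) ^ m * (r : ℝ≥0∞) ^ m ≤ K := by exact_mod_cast hrK.le
  have hrtop : (r : ℝ≥0∞) ^ m ≠ ⊤ := ENNReal.pow_ne_top ENNReal.coe_ne_top
  filter_upwards [h.eventually_volume_le hk hr] with f hf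
  exact ⟨(energyWith_le_of_le_smul f hf.2 hrtop).trans (by gcongr),
    (energyWith_le_of_le_smul f hf.1 hrtop).trans (by gcongr)⟩

theorem LocallyC2Tendsto.tendsto_energyOfMap (hm : 1 ≤ m) (hk : 2 ≤ k)
    [l.IsCountablyGenerated] (h : LocallyC2Tendsto l f₀) :
    Tendsto (fun f : Emb M n => energyOfMap f.toMap) l (𝓝 (energyOfMap f₀.toMap)) := by
  have := f₀.isFiniteMeasure_volume (one_le_two.trans hk)
  simp_rw [energyOfMap_eq_energyWith]
  exact tendsto_of_eventually_le_mul (h.tendsto_energyWith hm hk f₀.volume)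
    fun _ hK => h.eventually_energyWith_volume_le hk hK

end Energy

end KusnerSullivan

end

theorem mainTheorem3 (m n : ℕ) (hm : 1 ≤ m) (k : ℕ∞) (hk : 2 ≤ k) :
    (∀ S : KusnerSullivan.EmbeddedSubmanifold m n k, KusnerSullivan.energyKS hk S < ⊤) ∧
      @Continuous (KusnerSullivan.EmbeddedSubmanifold m n k) ℝ≥0∞
        (KusnerSullivan.submanifoldTopology m n k 2) ENNReal.instTopologicalSpace
        (KusnerSullivan.energyKS hk) := by
  refine ⟨fun S => Quot.inductionOn S fun a => KusnerSullivan.energyOfMap_lt_top hm hk a.2, ?_⟩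
  let (M : KusnerSullivan.ClosedOrientedManifold m k) : TopologicalSpace (KusnerSullivan.Emb M n) :=
    KusnerSullivan.embTopology 2 M n
  refine continuous_coinduced_dom.2 (continuous_sigma fun M => continuous_iff_continuousAt.2
    fun f => ?_)
  obtain ⟨l, _, hl, h⟩ := KusnerSullivan.exists_locallyC2Tendsto hk f
  exact (h.tendsto_energyOfMap hm hk).mono_left hl
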